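/- Conventions. Let $G$ be a countable discrete Abelian group. An infinite measure preserving $G$-action $T=(T_g)_{g\in G}$ is an action of $G$ by measure preserving Borel transformations of a standard Borel space $X$ equipped with a non-atomic, $\sigma$-finite measure $\mu$ such that $\mu(X)=\infty$. Put $T^{-1}:=(T_{-g})_{g\in G}$. Products of $G$-actions are diagonal: $(S\times R)_g:=S_g\times R_g$, acting on the product measure space. $T$ is *ergodic* if every $T$-invariant measurable set is null or has null complement. $T$ has *ergodic index* $k$ if the $k$-fold product $T\times\cdots\times T$ is ergodic and the $(k+1)$-fold product is not. $T$ is *rigid* if there is a sequence $g_n\to\infty$ in $G$ (it eventually leaves every finite set) with $\mu(T_{g_n}A\cap A)\to\mu(A)$ for each measurable set $A$ with $\mu(A)<\infty$. $T$ is of *funny rank one* if there are finite subsets $F_n\subset G$ and measurable sets $A_n$ with $\mu(A_n)<\infty$ such that $T_gA_n\cap T_hA_n=\emptyset$ whenever $g\neq h$ in $F_n$, and for each measurable set $B$ with $\mu(B)<\infty$ there are $S_n\subset F_n$ with $\mu\big(B\,\triangle\,\bigcup_{g\in S_n}T_gA_n\big)\to0$. If $G=\mathbb Z^d$ and the sets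 $F_n$ can be chosen to be cubes (products of $d$ intervals of integers with equally many points), then $T$ is of *rank one*. **Theorem 0.1.** Let $G$ be a countable discrete Abelian group with an element of infinite order. For each integer $k>0$ there is a rigid funny rank-one infinite measure preserving $G$-action $T$ of ergodic index $k$ such that, moreover, the $G$-action $$\underbrace{T\times\cdots\times T}_{m\text{ times}}\times\underbrace{T^{-1}\times\cdots\times T^{-1}}_{k-m\text{ times}}$$ is ergodic for every $m\in\{0,1,\dots,k-1\}$. Furthermore, if $G=\mathbb Z^d$ for some $d>0$, then $T$ with all these properties can be chosen of rank one. -/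

import Mathlib

open MeasureTheory Filter Topology

/-- `μ` is an infinite, `σ`-finite, non-atomic measure on a standard Borel space on which `G` acts
by measurable maps that preserve `μ`. -/
structure IsInfiniteMeasurePreserving (G : Type*) {X : Type*} [AddCommGroup G] [MeasurableSpace X]
    [AddAction G X] (μ : Measure X) : Prop where
  standardBorel : StandardBorelSpace X
  sigmaFinite : SigmaFinite μ
  nonatomic : ∀ x : X, μ {x} = 0
  infinite : μ Set.univ = ⊤
  measurePreserving : ∀ g : G, MeasurePreserving (fun x : X => g +ᵥ x) μ μ

/-- Rigidity: along some sequence `gₙ → ∞` in the discrete group `G` one has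
`μ (T_{gₙ} A ∩ A) → μ A` for all measurable sets `A` of finite measure. -/
def IsRigidAction (G : Type*) {X : Type*} [AddCommGroup G] [MeasurableSpace X]
    [AddAction G X] (μ : Measure X) : Prop :=
  ∃ g : ℕ → G, Tendsto g atTop cofinite ∧
    ∀ A : Set X, MeasurableSet A → μ A ≠ ⊤ →
      Tendsto (fun n => μ (((fun x => g n +ᵥ x) '' A) ∩ A)) atTop (𝓝 (μ A))

/-- The action is of funny rank one along the sequence `(Fₙ)` of finite subsets of `G`: there are
measurable sets `Aₙ` of finite measure such that the sets `T_g Aₙ`, `g ∈ Fₙ`, are pairwise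
disjoint, and every measurable set of finite measure is approximated, as `n → ∞`, by unions
of levels `T_g Aₙ`, `g ∈ Fₙ`, of the `n`-th tower. -/
def IsFunnyRankOneAlong {G X : Type*} [AddCommGroup G] [MeasurableSpace X]
    [AddAction G X] (μ : Measure X) (F : ℕ → Finset G) : Prop :=
  ∃ A : ℕ → Set X,
    (∀ n, MeasurableSet (A n) ∧ μ (A n) ≠ ⊤) ∧
    (∀ n, ∀ g ∈ F n, ∀ h ∈ F n, g ≠ h →
      Disjoint ((fun x => g +ᵥ x) '' A n) ((fun x => h +ᵥ x) '' A n)) ∧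
    ∀ B : Set X, MeasurableSet B → μ B ≠ ⊤ →
      ∃ S : ℕ → Finset G, (∀ n, S n ⊆ F n) ∧
        Tendsto (fun n => μ (symmDiff B (⋃ g ∈ S n, (fun x => g +ᵥ x) '' A n))) atTop (𝓝 0)

/-- Funny rank one. -/
def IsFunnyRankOne (G : Type*) {X : Type*} [AddCommGroup G] [MeasurableSpace X]
    [AddAction G X] (μ : Measure X) : Prop :=
  ∃ F : ℕ → Finset G, IsFunnyRankOneAlong μ F

/-- A cube in `ℤ^d`: a product of `d` intervals of integers with the same number of points. -/
def IsCube {d : ℕ} (F : Finset (Fin d → ℤ)) : Prop :=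
  ∃ (a : Fin d → ℤ) (L : ℕ), F = Finset.Icc a (fun i => a i + (L : ℤ))

/-- Rank one, for actions of `ℤ^d`: funny rank one along a sequence of cubes. -/
def IsRankOne (d : ℕ) {X : Type*} [MeasurableSpace X] [AddAction (Fin d → ℤ) X]
    (μ : Measure X) : Prop :=
  ∃ F : ℕ → Finset (Fin d → ℤ), (∀ n, IsCube (F n)) ∧ IsFunnyRankOneAlong μ F

/-- The action `T⁻¹ = (T_{-g})_{g ∈ G}` inverse to a given action `T`. -/
@[reducible] def inverseAction {G X : Type*} [AddCommGroup G] (T : AddAction G X) :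
    AddAction G X where
  vadd g x := -g +ᵥ x
  zero_vadd x := show -(0 : G) +ᵥ x = x by rw [neg_zero, zero_vadd]
  add_vadd g h x := show -(g + h) +ᵥ x = -g +ᵥ (-h +ᵥ x) by rw [neg_add, add_vadd]

/-- The product of finitely many actions `T i` of `G` on `X`: the diagonal action
`(g, x) ↦ (T i)_g (x i)` on `ι → X`. -/
@[reducible] def productAction {ι G X : Type*} [AddCommGroup G] (T : ι → AddAction G X) :
    AddAction G (ι → X) where
  vadd g x := fun i => (T i).toVAdd.vadd g (x i)
  zero_vadd x := funext fun i => (T i).zero_vadd (x i)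
  add_vadd g h x := funext fun i => (T i).add_vadd g h (x i)

/-- The product of the actions `T i`, `i : Fin n`, is ergodic for the `n`-th power of `μ`. -/
def ProductErgodic {n : ℕ} {G X : Type*} [AddCommGroup G] [MeasurableSpace X]
    (T : Fin n → AddAction G X) (μ : Measure X) : Prop :=
  @ErgodicVAdd G (Fin n → X) (productAction T).toVAdd _ (Measure.pi fun _ => μ)

/-- Ergodic index `k`: the `k`-fold product of the action is ergodic and the `(k+1)`-fold
product is not. -/
def HasErgodicIndex (G : Type*) {X : Type*} [AddCommGroup G] [MeasurableSpace X]
    [T : AddAction G X] (μ : Measure X) (k : ℕ) : Prop :=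
  ProductErgodic (fun _ : Fin k => T) μ ∧ ¬ ProductErgodic (fun _ : Fin (k + 1) => T) μ

/-- The product of `m` copies of `T` and `k - m` copies of `T⁻¹` (for `m ≤ k`) is ergodic. -/
def MixedProductErgodic (G : Type*) {X : Type*} [AddCommGroup G] [MeasurableSpace X]
    [T : AddAction G X] (μ : Measure X) (m k : ℕ) : Prop :=
  ProductErgodic (fun i : Fin k => if i.val < m then T else inverseAction T) μ

open scoped ENNReal

/-! The action comes from cutting and stacking inside the group: each level of tower `m` is cut into
`|C m|` levels of tower `m + 1` of equal mass. The condition `absorb` lets all of `G` act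
everywhere, and `growth` makes the measure infinite. Every tower consists of translates of one base,
so funny rank one is automatic, along whatever cofinal family the shapes `F m` are taken from
(cubes, when `G` is `ℤ^d`). The remaining properties are governed by the sets `C m`.

Some `C m` are long progressions with difference `h`, almost invariant under `h`; they give
rigidity. Every other `C m` has `q` elements and a prescribed defect `u`: it contains a triple `a,
b, d` with `d - b + u = b - a`, and outside at most three elements its differences are exact in the
sense of `ExactOff`.

Ergodicity of `k`-fold products: a diagonal translation by `b - a` turns the choice `a` into `b` in
all coordinates but one, and in that one turns `b` into a translate of `d` by `u`. So for an
invariant set, the density in a box and in the box with one coordinate moved by `u` have a common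
value at one of the `q ^ k` sub-boxes of each. If the `q⁻ᵏ` are not summable, the densities coincide
(`eq_of_averages`); hence the density is constant and the set is null or conull. Passing from `T` to
`T⁻¹` only changes a sign in this argument, so the mixed products are covered too
(`productErgodic`).

Failure for `k + 1` factors: unless all `k + 1` coordinates choose among the three special elements,
an event of probability at most `(3 / q) ^ (k + 1)`, exactness carries equality of the address
changes of all coordinates from stage `m + 1` down to stage `m` (`sub_eq_sub_of_vadd`). If these
probabilities sum to less than `1`, two boxes contain sets of positive measure that no translation
connects (`not_productErgodic`).

Both demands are compatible: a parameter `q` is used `q ^ k` times, contributing `1` to the first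
sum and only `3 ^ (k + 1) / q` to the second (`exists_schedule`). -/

/-! ### Combinatorial conditions on the cutting parameters. -/

/-- Cutting parameters `(F m, C m)` of a `(C,F)`-construction: `F m + C m` is a direct sum contained
in `F (m + 1)`. -/
structure CFData (G : Type*) [AddCommGroup G] where
  F : ℕ → Finset G
  C : ℕ → Finset G
  zero_mem : ∀ m, 0 ∈ F m
  two_le : ∀ m, 2 ≤ (C m).card
  add_mem : ∀ m, ∀ f ∈ F m, ∀ c ∈ C m, f + c ∈ F (m + 1)
  add_inj : ∀ m, ∀ f ∈ F m, ∀ f' ∈ F m, ∀ c ∈ C m, ∀ c' ∈ C m, f + c = f' + c' → c = c'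
  absorb : ∀ g, ∀ᶠ m in atTop, ∀ f ∈ F m, ∀ c ∈ C m, g + (f + c) ∈ F (m + 1)
  growth : ∀ m, 2 * ((F m).card * (C m).card) ≤ (F (m + 1)).card

/-- Outside `Q`, approximate equalities (up to `F`) between differences of elements of `C` are
exact. -/
def ExactOff {G : Type*} [AddCommGroup G] (F C Q : Finset G) : Prop :=
  ∀ p ∈ C, p ∉ Q → ∀ a ∈ C, ∀ c ∈ C, ∀ c' ∈ C, ∀ f₁ ∈ F, ∀ f₂ ∈ F, ∀ f₃ ∈ F, ∀ f₄ ∈ F,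
    (a - p) - (c' - c) = (f₁ - f₂) - (f₃ - f₄) → a - p = c' - c

/-- `C` contains two consecutive differences that differ by `u`. -/
def HasDefect {G : Type*} [AddCommGroup G] (C : Finset G) (u : G) : Prop :=
  ∃ a ∈ C, ∃ b ∈ C, ∃ d ∈ C, d - b + u = b - a

namespace CFData

variable {G : Type*} [AddCommGroup G]

open Classical in
/-- Infinitely many of the sets `C m` are almost invariant under a translation. -/
def RigidSteps (D : CFData G) : Prop :=
  ∃ (φ : ℕ → ℕ) (h : ℕ → G), StrictMono φ ∧ Tendsto h atTop cofinite ∧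
    ∀ n, (n + 1) * ((D.C (φ n)).filter fun c => c - h n ∉ D.C (φ n)).card ≤ (D.C (φ n)).card

open Classical in
/-- Each defect is seen infinitely often by generic `k`-tuples. -/
def Mixes (D : CFData G) (k : ℕ) : Prop :=
  ∀ u : G, ¬ Summable fun m => if HasDefect (D.C m) u then (((D.C m).card : ℝ) ^ k)⁻¹ else 0

/-- Generic `k`-tuples see non-exact differences only finitely often. -/
def Isolates (D : CFData G) (k : ℕ) : Prop :=
  ∃ Q : ℕ → Finset G, (∀ m, Q m ⊆ D.C m) ∧ (∀ m, ExactOff (D.F m) (D.C m) (Q m)) ∧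
    ∑' m, (((Q m).card : ℝ≥0∞) / (D.C m).card) ^ k < 1

end CFData

/-! ### Sidon sets and a single step of the construction. -/

/-- A set of integers containing `0, 1, 2` that is a Sidon set away from `0, 1, 2`. -/
theorem exists_sidon (q : ℕ) : ∃ S : Finset ℤ, S.card = q + 3 ∧ {0, 1, 2} ⊆ S ∧ (∀ s ∈ S, 0 ≤ s) ∧
    ∀ p ∈ S, 2 < p → ∀ a ∈ S, ∀ c ∈ S, ∀ c' ∈ S, a + c = p + c' → a = p ∨ c = p := by
  induction q with
  | zero =>
    refine ⟨{0, 1, 2}, by decide, subset_rfl, by decide, ?_⟩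
    intro p hp hp2
    simp at hp
    omega
  | succ q ih =>
    obtain ⟨S, hc, h012, h0, hS⟩ := ih
    obtain ⟨M, hM⟩ := S.bddAbove
    have hM : ∀ s ∈ S, s ≤ M := fun s hs => hM hs
    have hM2 : 2 ≤ M := hM 2 (h012 (by simp))
    -- The new element exceeds every sum of two old ones, so it can only occur on both sides of a
    -- relation.
    have hN : 2 * M + 1 ∉ S := fun h => by have := hM _ h; omega
    refine ⟨insert (2 * M + 1) S, by rw [Finset.card_insert_of_notMem hN, hc],
      h012.trans (Finset.subset_insert _ _), ?_, ?_⟩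
    · intro s hs
      rcases Finset.mem_insert.1 hs with rfl | hs
      · omega
      · exact h0 s hs
    · have key : ∀ x ∈ insert (2 * M + 1) S, x = 2 * M + 1 ∨ (x ∈ S ∧ 0 ≤ x ∧ x ≤ M) := by
        intro x hx
        rcases Finset.mem_insert.1 hx with rfl | hx
        · exact Or.inl rfl
        · exact Or.inr ⟨hx, h0 x hx, hM x hx⟩
      intro p hp hp2 a ha c hc c' hc' heq
      rcases key p hp with hp | ⟨hp, hp0, hp1⟩ <;> rcases key a ha with ha | ⟨ha, ha0, ha1⟩ <;>
        rcases key c hc with hc | ⟨hc, hc0, hc1⟩ <;> rcases key c' hc' with hc' | ⟨hc', hc0', hc1'⟩ <;>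
        first
        | omega
        | exact hS p hp hp2 a ha c hc c' hc' heq

section Step

variable {G : Type*} [AddCommGroup G]

/-- Only finitely many multiples of `h₀` lie in `K`; a multiple of `h₀` by an integer larger than
all the coefficients involved works. -/
theorem exists_multiples_notMem {h₀ : G} (hh : ¬ IsOfFinAddOrder h₀) (K : Finset G) :
    ∃ h : G, ∀ s : ℤ, s ≠ 0 → s • h ∉ K := by
  classical
  have hinj : Function.Injective fun t : ℤ => t • h₀ :=
    injective_zsmul_iff_not_isOfFinAddOrder.2 hh
  set T : Finset ℤ := K.preimage (fun t : ℤ => t • h₀) hinj.injOn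
  refine ⟨(1 + ∑ t ∈ T, |t|) • h₀, fun s hs hmem => ?_⟩
  have hN : 0 ≤ ∑ t ∈ T, |t| := Finset.sum_nonneg fun t _ => abs_nonneg t
  have hT : s * (1 + ∑ t ∈ T, |t|) ∈ T := by
    rw [Finset.mem_preimage, mul_zsmul]
    exact hmem
  have h1 : |s * (1 + ∑ t ∈ T, |t|)| ≤ ∑ t ∈ T, |t| :=
    Finset.single_le_sum (f := fun t : ℤ => |t|) (fun t _ => abs_nonneg t) hT
  rw [abs_mul, abs_of_nonneg (by omega : 0 ≤ 1 + ∑ t ∈ T, |t|)] at h1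
  have h2 : 1 ≤ |s| := Int.one_le_abs hs
  nlinarith

/-- The arithmetic progression `s ↦ s h`, with a defect `u` at `s = 2`. -/
def defectProgression (h u : G) (s : ℤ) : G := s • h - if s = 2 then u else 0

/-- The nonzero multiples of `h` are made to avoid all the finitely many errors that elements of `F`
and defects can produce. Approximate relations in the group then reduce to exact relations between
integer indices. -/
theorem exists_freiman {h₀ : G} (hh : ¬ IsOfFinAddOrder h₀) (K F : Finset G) (u : G) :
    ∃ h : G, h ∉ K ∧ ∀ s₁ s₂ s₃ s₄ : ℤ, ∀ f₁ ∈ F, ∀ f₂ ∈ F, ∀ f₃ ∈ F, ∀ f₄ ∈ F,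
      (defectProgression h u s₁ - defectProgression h u s₂) -
        (defectProgression h u s₃ - defectProgression h u s₄) = (f₁ - f₂) - (f₃ - f₄) →
      s₁ - s₂ = s₃ - s₄ := by
  classical
  let E : Finset G := {0, u}
  let K' : Finset G := K ∪ ((F ×ˢ F ×ˢ F ×ˢ F) ×ˢ (E ×ˢ E ×ˢ E ×ˢ E)).image fun p =>
    (p.1.1 - p.1.2.1) - (p.1.2.2.1 - p.1.2.2.2) +
      ((p.2.1 - p.2.2.1) - (p.2.2.2.1 - p.2.2.2.2))
  obtain ⟨h, hK⟩ := exists_multiples_notMem hh K'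
  refine ⟨h, fun hm => hK 1 one_ne_zero (by rw [one_zsmul]; exact Finset.mem_union_left _ hm), ?_⟩
  intro s₁ s₂ s₃ s₄ f₁ h₁ f₂ h₂ f₃ h₃ f₄ h₄ heq
  by_contra hne
  refine hK (s₁ - s₂ - (s₃ - s₄)) (by omega) (Finset.mem_union_right _ ?_)
  have hE : ∀ s : ℤ, (if s = 2 then u else 0) ∈ E := by
    intro s
    split_ifs <;> simp [E]
  refine Finset.mem_image.2 ⟨⟨⟨f₁, f₂, f₃, f₄⟩, ⟨if s₁ = 2 then u else 0, if s₂ = 2 then u else 0,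
    if s₃ = 2 then u else 0, if s₄ = 2 then u else 0⟩⟩, ?_, ?_⟩
  · simp only [Finset.mem_product]
    exact ⟨⟨h₁, h₂, h₃, h₄⟩, hE _, hE _, hE _, hE _⟩
  · simp only [← heq, defectProgression, sub_zsmul]
    abel

open Classical in
/-- The requirements on one step `F ↦ (C, F')` of the construction: either a rigid step, or a step
with `q` copies and defect `u`. -/
structure StepSpec (e : G ≃ ℕ) (m : ℕ) (st : Option (G × ℕ)) (F C F' : Finset G) : Prop where
  two_le : 2 ≤ C.card
  add_inj : ∀ f ∈ F, ∀ f' ∈ F, ∀ c ∈ C, ∀ c' ∈ C, f + c = f' + c' → c = c'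
  exact : ∃ Q ⊆ C, ExactOff F C Q ∧ (st = none → Q = ∅) ∧ Q.card ≤ 3
  rigid : st = none → ∃ h : G, (∀ i ≤ m, h ≠ e.symm i) ∧
    (m + 1) * (C.filter fun c => c - h ∉ C).card ≤ C.card
  mixing : ∀ u q, st = some (u, q) → C.card = q ∧ HasDefect C u
  zero_mem : 0 ∈ F'
  add_mem : ∀ f ∈ F, ∀ c ∈ C, f + c ∈ F'
  absorb : ∀ i ≤ m, ∀ f ∈ F, ∀ c ∈ C, e.symm i + (f + c) ∈ F'
  growth : 2 * (F.card * C.card) ≤ F'.card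

/-- The conditions on `F'` only ask that it contain a finite set or be large, so cofinality of `𝓕`
settles them once `C` is known. The set `C` is the image of an interval (rigid step) or of a
Sidon-type set (mixing step) under `defectProgression`. -/
theorem exists_step (e : G ≃ ℕ) {h₀ : G} (hh : ¬ IsOfFinAddOrder h₀) {𝓕 : Set (Finset G)}
    (h𝓕 : ∀ K : Finset G, ∃ F ∈ 𝓕, K ⊆ F) (m : ℕ) (st : Option (G × ℕ))
    (hst : ∀ u q, st = some (u, q) → 3 ≤ q) (F : Finset G) (hF : F.Nonempty) :
    ∃ C, ∃ F' ∈ 𝓕, StepSpec e m st F C F' := by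
  classical
  suffices H : ∃ C : Finset G, 2 ≤ C.card ∧
      (∀ f ∈ F, ∀ f' ∈ F, ∀ c ∈ C, ∀ c' ∈ C, f + c = f' + c' → c = c') ∧
      (∃ Q ⊆ C, ExactOff F C Q ∧ (st = none → Q = ∅) ∧ Q.card ≤ 3) ∧
      (st = none → ∃ h : G, (∀ i ≤ m, h ≠ e.symm i) ∧
        (m + 1) * (C.filter fun c => c - h ∉ C).card ≤ C.card) ∧
      (∀ u q, st = some (u, q) → C.card = q ∧ HasDefect C u) by
    obtain ⟨C, h1, h2, h3, h4, h5⟩ := H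
    have : Infinite G := e.infinite_iff.2 inferInstance
    obtain ⟨E, hE⟩ := Infinite.exists_subset_card_eq G (2 * (F.card * C.card))
    obtain ⟨F', hF', hsub⟩ := h𝓕 ({0} ∪ E ∪ (F ×ˢ C).image (fun p => p.1 + p.2) ∪
      ((Finset.range (m + 1)) ×ˢ (F ×ˢ C)).image (fun p => e.symm p.1 + (p.2.1 + p.2.2)))
    refine ⟨C, F', hF', h1, h2, h3, h4, h5, ?_, ?_, ?_, ?_⟩
    · exact hsub (by simp)
    · intro f hf c hc
      refine hsub (Finset.mem_union_left _ (Finset.mem_union_right _ ?_))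
      exact Finset.mem_image.2 ⟨(f, c), Finset.mk_mem_product hf hc, rfl⟩
    · intro i hi f hf c hc
      refine hsub (Finset.mem_union_right _ ?_)
      exact Finset.mem_image.2 ⟨(i, (f, c)), Finset.mk_mem_product
        (Finset.mem_range.2 (by omega)) (Finset.mk_mem_product hf hc), rfl⟩
    · rw [← hE]
      exact Finset.card_le_card (fun x hx => hsub (by simp [hx]))
  obtain ⟨f₀, hf₀⟩ := hF
  -- Taking three of the four indices equal in the Freiman property gives injectivity of the
  -- progression and directness of the sum with `F`.
  have aux : ∀ (h u : G) (S : Finset ℤ), (∀ s₁ s₂ s₃ s₄ : ℤ, ∀ f₁ ∈ F, ∀ f₂ ∈ F, ∀ f₃ ∈ F, ∀ f₄ ∈ F,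
      (defectProgression h u s₁ - defectProgression h u s₂) -
        (defectProgression h u s₃ - defectProgression h u s₄) = (f₁ - f₂) - (f₃ - f₄) →
      s₁ - s₂ = s₃ - s₄) → (S.image (defectProgression h u)).card = S.card ∧
      (∀ f ∈ F, ∀ f' ∈ F, ∀ c ∈ S.image (defectProgression h u),
        ∀ c' ∈ S.image (defectProgression h u), f + c = f' + c' → c = c') := by
    intro h u S H
    refine ⟨Finset.card_image_of_injective _ fun s s' hs => ?_, ?_⟩
    · have := H s s' s' s' f₀ hf₀ f₀ hf₀ f₀ hf₀ f₀ hf₀ (by rw [hs]; abel)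
      omega
    · intro f hf f' hf' c hc c' hc' heq
      obtain ⟨s, -, rfl⟩ := Finset.mem_image.1 hc
      obtain ⟨s', -, rfl⟩ := Finset.mem_image.1 hc'
      have := H s s' s' s' f' hf' f hf f₀ hf₀ f₀ hf₀ (by
        have : defectProgression h u s = f' - f + defectProgression h u s' := by
          rw [sub_add_eq_add_sub, ← heq]; abel
        rw [this]; abel)
      rw [show s = s' by omega]
  rcases st with _ | ⟨u, q⟩
  · obtain ⟨h, hK, H⟩ := exists_freiman hh ((Finset.range (m + 1)).image e.symm) F 0
    obtain ⟨hcard, hinj⟩ := aux h 0 (Finset.Ico 0 ((m : ℤ) + 2)) H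
    have hlin : ∀ s, defectProgression h 0 s = s • h := by
      intro s; simp [defectProgression]
    refine ⟨(Finset.Ico 0 ((m : ℤ) + 2)).image (defectProgression h 0), ?_, hinj, ?_, ?_, ?_⟩
    · rw [hcard]; simp; omega
    · refine ⟨∅, Finset.empty_subset _, ?_, fun _ => rfl, by simp⟩
      intro p hp _ a ha c hc c' hc' f₁ h₁ f₂ h₂ f₃ h₃ f₄ h₄ heq
      obtain ⟨sp, -, rfl⟩ := Finset.mem_image.1 hp
      obtain ⟨sa, -, rfl⟩ := Finset.mem_image.1 ha
      obtain ⟨sc, -, rfl⟩ := Finset.mem_image.1 hc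
      obtain ⟨sc', -, rfl⟩ := Finset.mem_image.1 hc'
      have := H sa sp sc' sc f₁ h₁ f₂ h₂ f₃ h₃ f₄ h₄ heq
      simp only [hlin, sub_eq_add_neg, ← neg_zsmul, ← add_zsmul]
      simp only [← sub_eq_add_neg, this]
    · intro _
      refine ⟨h, ?_, ?_⟩
      · intro i hi heq
        exact hK (Finset.mem_image.2 ⟨i, Finset.mem_range.2 (by omega), heq.symm⟩)
      -- Only the initial term `0` of the `m + 2` terms leaves the progression when shifted by `-h`.
      · have hle : ((Finset.image (defectProgression h 0) (Finset.Ico 0 ((m : ℤ) + 2))).filter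
            fun c => c - h ∉ Finset.image (defectProgression h 0) (Finset.Ico 0 ((m : ℤ) + 2))) ⊆
            {0} := by
          intro c hc
          obtain ⟨hc1, hc2⟩ := Finset.mem_filter.1 hc
          obtain ⟨s, hs, rfl⟩ := Finset.mem_image.1 hc1
          rw [Finset.mem_singleton, hlin]
          by_contra hne
          refine hc2 (Finset.mem_image.2 ⟨s - 1, ?_, ?_⟩)
          · rw [Finset.mem_Ico] at hs ⊢
            have : s ≠ 0 := by rintro rfl; simp at hne
            omega
          · rw [hlin, hlin, sub_zsmul, one_zsmul, sub_eq_add_neg]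
        have := Finset.card_le_card hle
        rw [Finset.card_singleton] at this
        rw [hcard]
        simp only [Int.card_Ico]
        have h2 : ((m : ℤ) + 2 - 0).toNat = m + 2 := by omega
        rw [h2]
        nlinarith
    · intro u q h; cases h
  · obtain ⟨S, hScard, h012, hpos, hS⟩ := exists_sidon (q - 3)
    have hq : 3 ≤ q := hst u q rfl
    obtain ⟨h, -, H⟩ := exists_freiman hh ∅ F u
    obtain ⟨hcard, hinj⟩ := aux h u S H
    have hm : ∀ s ∈ ({0, 1, 2} : Finset ℤ),
        defectProgression h u s ∈ S.image (defectProgression h u) :=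
      fun s hs => Finset.mem_image_of_mem _ (h012 hs)
    refine ⟨S.image (defectProgression h u), by omega, hinj, ?_, ?_, ?_⟩
    · refine ⟨({0, 1, 2} : Finset ℤ).image (defectProgression h u), Finset.image_subset_image h012,
        ?_, by simp, Finset.card_image_le⟩
      have hout : ∀ s ∈ S, defectProgression h u s ∉
          ({0, 1, 2} : Finset ℤ).image (defectProgression h u) → 2 < s := by
        intro s hs hn
        by_contra hle
        have := hpos s hs
        refine hn (Finset.mem_image_of_mem _ ?_)
        simp only [Finset.mem_insert, Finset.mem_singleton]
        omega
      intro p hp hpQ a ha c hc c' hc' f₁ h₁ f₂ h₂ f₃ h₃ f₄ h₄ heq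
      obtain ⟨sp, hsp, rfl⟩ := Finset.mem_image.1 hp
      obtain ⟨sa, hsa, rfl⟩ := Finset.mem_image.1 ha
      obtain ⟨sc, hsc, rfl⟩ := Finset.mem_image.1 hc
      obtain ⟨sc', hsc', rfl⟩ := Finset.mem_image.1 hc'
      have hs := H sa sp sc' sc f₁ h₁ f₂ h₂ f₃ h₃ f₄ h₄ heq
      -- Either both differences vanish or they have the same endpoints; in neither case does the
      -- defect at index `2` matter.
      rcases hS sp hsp (hout sp hsp hpQ) sa hsa sc hsc sc' hsc' (by omega) with rfl | rfl
      · rw [show sc' = sc by omega, sub_self, sub_self]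
      · rw [show sc' = sa by omega]
    · intro h; cases h
    · rintro u' q' ⟨⟩
      refine ⟨by omega, _, hm 0 (by simp), _, hm 1 (by simp), _, hm 2 (by simp), ?_⟩
      simp only [defectProgression, two_zsmul, one_zsmul, zero_zsmul]
      simp
      abel

end Step

/-! ### The schedule of rigid and mixing steps. -/

section Schedule

variable {G : Type*}

/-- Steps are indexed by infinitely many rigid ones and, for each pair `(u, j)`, a block of `q ^ k`
mixing steps with defect `u`. For fixed `u` each block adds `1` to the sum of `κ`, and there is one
for each `j`. In the last sum a block adds `3 ^ (k + 1) / q`, which is a quarter of a term of the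
geometric series of ratio `1/2`, so the total is at most `1/2`. -/
theorem exists_schedule (e : G ≃ ℕ) (k : ℕ) : ∃ st : ℕ → Option (G × ℕ),
    (∀ m u q, st m = some (u, q) → 3 ≤ q) ∧
    (∃ φ : ℕ → ℕ, StrictMono φ ∧ ∀ n, st (φ n) = none) ∧
    (∀ u : G, ∀ κ : ℕ → ℝ, (∀ m, 0 ≤ κ m) → (∀ m q, st m = some (u, q) → κ m = ((q : ℝ) ^ k)⁻¹) →
      ¬ Summable κ) ∧
    ∑' m, (st m).elim 0 (fun p => (3 / (p.2 : ℝ≥0∞)) ^ (k + 1)) < 1 := by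
  classical
  let c : G × ℕ → ℕ := fun p => Nat.pair (e p.1) p.2
  have hc : Function.Injective c := by
    rintro ⟨a, b⟩ ⟨a', b'⟩ h
    have := Nat.pair_eq_pair.1 h
    simpa using this
  -- The factor `3 ^ (k + 1)` cancels the three special elements, `2 ^ c p` gives summability over
  -- the injective codes, and `4` brings the total below `1`.
  let q : G × ℕ → ℕ := fun p => 4 * 3 ^ (k + 1) * 2 ^ c p
  have hq0 : ∀ p, 0 < q p := fun p => by positivity
  let I := ℕ ⊕ Σ p : G × ℕ, Fin (q p ^ k)
  have : Countable G := e.countable_iff.2 inferInstance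
  obtain ⟨_⟩ := nonempty_denumerable I
  let E : ℕ ≃ I := (Denumerable.eqv I).symm
  let T : I → Option (G × ℕ) := Sum.elim (fun _ => none) (fun p => some (p.1.1, q p.1))
  refine ⟨fun m => T (E m), ?_, ?_, ?_, ?_⟩
  · intro m u r h
    change T (E m) = _ at h
    rcases hE : E m with i | ⟨p, t⟩
    · rw [hE] at h; cases h
    · rw [hE] at h
      cases h
      have h1 : 1 ≤ 3 ^ (k + 1) * 2 ^ c p := Nat.one_le_iff_ne_zero.2 (by positivity)
      change 3 ≤ 4 * 3 ^ (k + 1) * 2 ^ c p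
      nlinarith
  · have : ∃ᶠ m in atTop, T (E m) = none := by
      rw [Nat.frequently_atTop_iff_infinite]
      refine Set.infinite_of_injective_forall_mem (f := fun n : ℕ => E.symm (Sum.inl n)) ?_ ?_
      · intro a b h
        exact Sum.inl_injective (E.symm.injective h)
      · intro n
        simp [T]
    exact extraction_of_frequently_atTop this
  · intro u κ h0 hκ hs
    let ι : (Σ j : ℕ, Fin (q (u, j) ^ k)) → I := fun p => Sum.inr ⟨(u, p.1), p.2⟩
    have hι : Function.Injective ι := by
      rintro ⟨j, t⟩ ⟨j', t'⟩ h
      have h := Sum.inr.inj h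
      simp only [Sigma.mk.injEq, Prod.mk.injEq, true_and] at h
      obtain ⟨rfl, h⟩ := h
      simpa using h
    have h1 := ((E.symm.summable_iff).2 hs).comp_injective hι
    have h2 := h1.sigma
    have h3 : ∀ j : ℕ, ∑' t : Fin (q (u, j) ^ k), ((κ ∘ E.symm) ∘ ι) ⟨j, t⟩ = 1 := by
      intro j
      have : ∀ t : Fin (q (u, j) ^ k), ((κ ∘ E.symm) ∘ ι) ⟨j, t⟩ = ((q (u, j) : ℝ) ^ k)⁻¹ := by
        intro t
        exact hκ _ _ (by simp [T, ι])
      simp only [this, tsum_fintype, Finset.sum_const, Finset.card_univ, Fintype.card_fin,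
        nsmul_eq_mul]
      have := hq0 (u, j)
      push_cast
      field_simp
    simp only [h3] at h2
    exact one_ne_zero (summable_const_iff (1 : ℝ) |>.1 h2)
  · rw [E.tsum_eq (fun i => (T i).elim 0 (fun p => (3 / (p.2 : ℝ≥0∞)) ^ (k + 1))),
      Summable.tsum_sum ENNReal.summable ENNReal.summable, ENNReal.tsum_sigma']
    have hterm : ∀ p : G × ℕ, ∑' t : Fin (q p ^ k), (T (Sum.inr ⟨p, t⟩)).elim (0 : ℝ≥0∞)
        (fun p => (3 / (p.2 : ℝ≥0∞)) ^ (k + 1)) = 4⁻¹ * (2⁻¹ : ℝ≥0∞) ^ c p := by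
      intro p
      simp only [T, Sum.elim_inr, Option.elim_some, tsum_fintype, Finset.sum_const,
        Finset.card_univ, Fintype.card_fin, nsmul_eq_mul]
      rw [← ENNReal.toReal_eq_toReal_iff' (by finiteness [(hq0 p).ne']) (by finiteness)]
      simp only [ENNReal.toReal_mul, ENNReal.toReal_pow, ENNReal.toReal_div, ENNReal.toReal_natCast,
        ENNReal.toReal_ofNat, ENNReal.toReal_inv]
      have h1 : (q p : ℝ) = 4 * 3 ^ (k + 1) * 2 ^ c p := by simp [q]
      have h2 : (q p : ℝ) ≠ 0 := by exact_mod_cast (hq0 p).ne'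
      rw [div_pow, pow_succ (q p : ℝ)]
      push_cast
      rw [show (q p : ℝ) ^ k * (3 ^ (k + 1) / ((q p : ℝ) ^ k * (q p : ℝ))) = 3 ^ (k + 1) / q p by
        field_simp, h1, inv_pow]
      field_simp
    have hzero : ∑' n : ℕ, (T (Sum.inl n)).elim (0 : ℝ≥0∞)
        (fun p => (3 / (p.2 : ℝ≥0∞)) ^ (k + 1)) = 0 := by
      simp [T]
    rw [hzero, zero_add, tsum_congr hterm]
    calc ∑' p : G × ℕ, 4⁻¹ * (2⁻¹ : ℝ≥0∞) ^ c p
        ≤ ∑' n : ℕ, 4⁻¹ * (2⁻¹ : ℝ≥0∞) ^ n :=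
          ENNReal.tsum_comp_le_tsum_of_injective hc fun n => 4⁻¹ * (2⁻¹ : ℝ≥0∞) ^ n
      _ = 4⁻¹ * 2 := by rw [ENNReal.tsum_mul_left, ENNReal.tsum_geometric]; simp
      _ < 1 := by
        rw [← ENNReal.toReal_lt_toReal (by finiteness) (by finiteness)]
        norm_num

end Schedule

/-! ### Existence of the cutting parameters. -/

section Existence

variable {G : Type*} [AddCommGroup G]

theorem CFData.exists_data (e : G ≃ ℕ) {h₀ : G} (hh : ¬ IsOfFinAddOrder h₀) {𝓕 : Set (Finset G)}
    (h𝓕 : ∀ K : Finset G, ∃ F ∈ 𝓕, K ⊆ F) (k : ℕ) :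
    ∃ D : CFData G, (∀ m, D.F m ∈ 𝓕) ∧ h₀ ∈ D.F 0 ∧ D.RigidSteps ∧ D.Mixes k ∧
      D.Isolates (k + 1) := by
  classical
  obtain ⟨st, hq, ⟨φ, hφ, hφst⟩, hmix, hiso⟩ := exists_schedule e k
  obtain ⟨F₀, hF₀, h0F₀⟩ := h𝓕 {0, h₀}
  let P := {F : Finset G // F ∈ 𝓕 ∧ (0 : G) ∈ F}
  have hstep : ∀ (m : ℕ) (F : P), ∃ CF : Finset G × P, StepSpec e m (st m) F.1 CF.1 CF.2.1 := by
    intro m F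
    obtain ⟨C, F', hF', h⟩ := exists_step e hh h𝓕 m (st m) (hq m) F.1 ⟨0, F.2.2⟩
    exact ⟨⟨C, ⟨F', hF', h.zero_mem⟩⟩, h⟩
  choose nx hnx using hstep
  let F : ℕ → P := fun m => Nat.rec ⟨F₀, hF₀, h0F₀ (by simp)⟩ (fun m F => (nx m F).2) m
  have hF : ∀ m, StepSpec e m (st m) (F m).1 (nx m (F m)).1 (F (m + 1)).1 := fun m => hnx m (F m)
  let D : CFData G :=
    { F := fun m => (F m).1
      C := fun m => (nx m (F m)).1
      zero_mem := fun m => (F m).2.2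
      two_le := fun m => (hF m).two_le
      add_mem := fun m => (hF m).add_mem
      add_inj := fun m => (hF m).add_inj
      absorb := fun g => by
        filter_upwards [eventually_ge_atTop (e g)] with m hm f hf c hc
        simpa using (hF m).absorb (e g) hm f hf c hc
      growth := fun m => (hF m).growth }
  have hD : ∀ m, StepSpec e m (st m) (D.F m) (D.C m) (D.F (m + 1)) := hF
  refine ⟨D, fun m => (F m).2.1, h0F₀ (by simp), ?_, ?_, ?_⟩
  · choose h hh1 hh2 using fun n => (hD (φ n)).rigid (hφst n)
    refine ⟨φ, h, hφ, ?_, fun n => ?_⟩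
    -- The step `h n` avoids the first `φ n + 1` elements in the enumeration of `G`, hence tends to
    -- infinity.
    · refine le_cofinite_iff_eventually_ne.2 fun g => ?_
      rw [eventually_map]
      filter_upwards [eventually_ge_atTop (e g)] with n hn
      simpa using hh1 n (e g) (hn.trans hφ.le_apply)
    · refine le_trans (Nat.mul_le_mul_right _ ?_) (hh2 n)
      have := hφ.le_apply (x := n)
      omega
  · intro u
    refine hmix u _ (fun m => by positivity) fun m q h => ?_
    obtain ⟨h1, h2⟩ := (hD m).mixing u q h
    rw [if_pos h2, h1]
  · choose Q hQC hQ hQ0 hQ3 using fun m => (hD m).exact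
    refine ⟨Q, hQC, hQ, lt_of_le_of_lt (ENNReal.tsum_le_tsum fun m => ?_) hiso⟩
    rcases hs : st m with _ | ⟨u, q⟩
    · simp [hQ0 m hs]
    · simp only [Option.elim_some]
      rw [((hD m).mixing u q hs).1]
      gcongr
      exact_mod_cast hQ3 m

end Existence

/-! ### Level systems and their normalized measures. -/

/-- Uniqueness of a measure with prescribed finite values on a generating nested family of sets. -/
theorem MeasureTheory.Measure.ext_of_nested {Z ι : Type*} [mZ : MeasurableSpace Z] [Countable ι]
    {B : ℕ → ι → Set Z} {I : ℕ → Set ι}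
    (hgen : mZ = MeasurableSpace.generateFrom {s | ∃ m, ∃ i ∈ I m, s = B m i})
    (hnest : ∀ m M, m ≤ M → ∀ i ∈ I m, ∀ j ∈ I M, (B m i ∩ B M j).Nonempty → B M j ⊆ B m i)
    (hcover : ∀ z, ∃ m, ∃ i ∈ I m, z ∈ B m i) {μ ν : Measure Z}
    (heq : ∀ m, ∀ i ∈ I m, μ (B m i) = ν (B m i)) (hfin : ∀ m, ∀ i ∈ I m, μ (B m i) ≠ ⊤) :
    μ = ν := by
  have hcount : {s | ∃ m, ∃ i ∈ I m, s = B m i}.Countable := by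
    refine (Set.countable_range fun p : ℕ × ι => B p.1 p.2).mono ?_
    rintro s ⟨m, i, -, rfl⟩
    exact ⟨(m, i), rfl⟩
  refine Measure.ext_of_generateFrom_of_cover_subset hgen ?_ subset_rfl hcount ?_ ?_ ?_
  · rintro _ ⟨m, i, hi, rfl⟩ _ ⟨M, j, hj, rfl⟩ hne
    rcases le_total m M with h | h
    · rw [Set.inter_eq_right.2 (hnest m M h i hi j hj hne)]
      exact ⟨M, j, hj, rfl⟩
    · rw [Set.inter_eq_left.2 (hnest M m h j hj i hi (by rwa [Set.inter_comm]))]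
      exact ⟨m, i, hi, rfl⟩
  · refine Set.eq_univ_of_forall fun z => ?_
    obtain ⟨m, i, hi, hz⟩ := hcover z
    exact ⟨_, ⟨m, i, hi, rfl⟩, hz⟩
  · rintro _ ⟨m, i, hi, rfl⟩
    exact hfin m i hi
  · rintro _ ⟨m, i, hi, rfl⟩
    exact heq m i hi

/-- The sets `U m f = T_f A_m` of a `(C,F)`-action with cutting parameters `D`; the levels of the
`m`-th tower are the sets `U m f` with `f ∈ F m`. -/
structure IsLevelSystem {G X : Type*} [AddCommGroup G] [mX : MeasurableSpace X] [AddAction G X]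
    (D : CFData G) (U : ℕ → G → Set X) : Prop where
  generate : mX = MeasurableSpace.generateFrom {s | ∃ m f, s = U m f}
  vadd_mem : ∀ m f g x, g +ᵥ x ∈ U m (g + f) ↔ x ∈ U m f
  disj : ∀ m, ∀ f ∈ D.F m, ∀ f' ∈ D.F m, ∀ x, x ∈ U m f → x ∈ U m f' → f = f'
  split : ∀ m f x, x ∈ U m f ↔ ∃ c ∈ D.C m, x ∈ U (m + 1) (f + c)
  cover : ∀ x, ∃ m f, x ∈ U m f

/-- The measure of a level of the `m`-th tower. -/
noncomputable def CFData.weight {G : Type*} [AddCommGroup G] (D : CFData G) (m : ℕ) : ℝ≥0∞ :=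
  ∏ j ∈ Finset.range m, ((D.C j).card : ℝ≥0∞)⁻¹

namespace CFData

variable {G : Type*} [AddCommGroup G] (D : CFData G)

theorem card_pos (m : ℕ) : 0 < (D.C m).card := by
  have := D.two_le m
  omega

theorem weight_ne_top (m : ℕ) : D.weight m ≠ ⊤ := by
  refine ENNReal.prod_ne_top fun j _ => ENNReal.inv_ne_top.2 ?_
  exact_mod_cast (D.card_pos j).ne'

theorem weight_ne_zero (m : ℕ) : D.weight m ≠ 0 :=
  Finset.prod_ne_zero_iff.2 fun _ _ => ENNReal.inv_ne_zero.2 (ENNReal.natCast_ne_top _)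

theorem weight_succ (m : ℕ) : ((D.C m).card : ℝ≥0∞) * D.weight (m + 1) = D.weight m := by
  rw [weight, Finset.prod_range_succ, mul_comm, mul_assoc, ENNReal.inv_mul_cancel, mul_one]
  · rfl
  · exact_mod_cast (D.card_pos m).ne'
  · exact ENNReal.natCast_ne_top _

theorem weight_le (m : ℕ) : D.weight m ≤ 2⁻¹ ^ m := by
  rw [weight, ← Finset.card_range m, ← Finset.prod_const, Finset.card_range]
  refine Finset.prod_le_prod' fun j _ => ENNReal.inv_le_inv.2 ?_
  exact_mod_cast D.two_le j

/-- By `growth`, the mass of the tower at least doubles at each stage; this is what makes the total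
measure infinite. -/
theorem two_pow_le (m : ℕ) : (2 : ℝ≥0∞) ^ m ≤ (D.F m).card * D.weight m := by
  induction m with
  | zero =>
    have := Finset.card_pos.2 ⟨0, D.zero_mem 0⟩
    simp only [pow_zero, weight, Finset.range_zero, Finset.prod_empty, mul_one]
    exact_mod_cast this
  | succ m ih =>
    calc (2 : ℝ≥0∞) ^ (m + 1) ≤ (D.F m).card * D.weight m * 2 := by rw [pow_succ]; gcongr
      _ = ((2 * ((D.F m).card * (D.C m).card) : ℕ) : ℝ≥0∞) * D.weight (m + 1) := by
        rw [← D.weight_succ]; push_cast; ring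
      _ ≤ _ := by
        gcongr
        exact_mod_cast D.growth m

end CFData

namespace IsLevelSystem

variable {G X : Type*} [AddCommGroup G] [mX : MeasurableSpace X] [AddAction G X]
  {D : CFData G} {U : ℕ → G → Set X}

theorem measurableSet (hU : IsLevelSystem D U) (m : ℕ) (f : G) : MeasurableSet (U m f) := by
  rw [hU.generate]
  exact MeasurableSpace.measurableSet_generateFrom ⟨m, f, rfl⟩

theorem vadd_mem_iff (hU : IsLevelSystem D U) (m : ℕ) (f g : G) (x : X) :
    g +ᵥ x ∈ U m f ↔ x ∈ U m (f - g) := by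
  rw [← hU.vadd_mem m (f - g) g, add_sub_cancel]

theorem image_vadd (hU : IsLevelSystem D U) (m : ℕ) (f g : G) :
    (fun x => g +ᵥ x) '' U m f = U m (g + f) := by
  ext x
  constructor
  · rintro ⟨y, hy, rfl⟩
    exact (hU.vadd_mem m f g y).2 hy
  · intro hx
    refine ⟨-g +ᵥ x, ?_, vadd_neg_vadd g x⟩
    rwa [hU.vadd_mem_iff, sub_neg_eq_add, add_comm]

theorem succ_subset (hU : IsLevelSystem D U) {m : ℕ} {c : G} (hc : c ∈ D.C m) (f : G) :
    U (m + 1) (f + c) ⊆ U m f :=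
  fun x hx => (hU.split m f x).2 ⟨c, hc, hx⟩

theorem exists_mem_of_le (hU : IsLevelSystem D U) {m M : ℕ} (hM : m ≤ M) {f : G} (hf : f ∈ D.F m)
    {x : X} (hx : x ∈ U m f) : ∃ f' ∈ D.F M, x ∈ U M f' := by
  induction M, hM using Nat.le_induction with
  | base => exact ⟨f, hf, hx⟩
  | succ M _ ih =>
    obtain ⟨f', hf', hx'⟩ := ih
    obtain ⟨c, hc, hxc⟩ := (hU.split M f' x).1 hx'
    exact ⟨f' + c, D.add_mem M f' hf' c hc, hxc⟩

/-- A common point has only one address in each tower, and its address at stage `M` must extend the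
one at stage `m`. -/
theorem nested (hU : IsLevelSystem D U) {m M : ℕ} (hM : m ≤ M) {f : G} (hf : f ∈ D.F m) {f' : G}
    (hf' : f' ∈ D.F M) (hne : (U m f ∩ U M f').Nonempty) : U M f' ⊆ U m f := by
  induction M, hM using Nat.le_induction generalizing f' with
  | base =>
    obtain ⟨x, hx, hx'⟩ := hne
    rw [hU.disj m f hf f' hf' x hx hx']
  | succ M hM ih =>
    obtain ⟨x, hx, hx'⟩ := hne
    obtain ⟨f₁, hf₁, hx₁⟩ := hU.exists_mem_of_le hM hf hx
    obtain ⟨c, hc, hxc⟩ := (hU.split M f₁ x).1 hx₁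
    rw [hU.disj (M + 1) f' hf' (f₁ + c) (D.add_mem M f₁ hf₁ c hc) x hx' hxc]
    exact (hU.succ_subset hc f₁).trans (ih hf₁ ⟨x, hx, hx₁⟩)

/-- Arbitrary translates of the base of a tower are refined by levels of higher towers. -/
theorem exists_refine (hU : IsLevelSystem D U) {m : ℕ} {g : G} {x : X} (hx : x ∈ U m g) (N : ℕ) :
    ∃ M, N ≤ M ∧ ∃ f ∈ D.F M, x ∈ U M f ∧ U M f ⊆ U m g := by
  have key : ∀ j, ∃ d ∈ D.F (m + j), x ∈ U (m + j) (g + d) ∧ U (m + j) (g + d) ⊆ U m g := by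
    intro j
    induction j with
    | zero => exact ⟨0, D.zero_mem m, by simpa using hx, by simp⟩
    | succ j ih =>
      obtain ⟨d, hd, hxd, hsub⟩ := ih
      obtain ⟨c, hc, hxc⟩ := (hU.split _ _ x).1 hxd
      refine ⟨d + c, D.add_mem _ d hd c hc, ?_, ?_⟩
      · simpa only [add_assoc] using hxc
      · have := (hU.succ_subset hc _).trans hsub
        simpa only [add_assoc] using this
  -- From here on, one more cut moves the translate by `g` back among the genuine levels of the next
  -- tower.
  obtain ⟨N', hN'⟩ := eventually_atTop.1 (D.absorb g)
  obtain ⟨d, hd, hxd, hsub⟩ := key (N + N')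
  obtain ⟨c, hc, hxc⟩ := (hU.split _ _ x).1 hxd
  refine ⟨m + (N + N') + 1, by omega, g + (d + c), hN' _ (by omega) d hd c hc, ?_, ?_⟩
  · simpa only [add_assoc] using hxc
  · have := (hU.succ_subset hc _).trans hsub
    simpa only [add_assoc] using this

theorem exists_mem (hU : IsLevelSystem D U) (x : X) : ∃ N, ∀ M ≥ N, ∃ f ∈ D.F M, x ∈ U M f := by
  obtain ⟨m, g, hx⟩ := hU.cover x
  obtain ⟨N, -, f, hf, hxf, -⟩ := hU.exists_refine hx 0
  exact ⟨N, fun M hM => hU.exists_mem_of_le hM hf hxf⟩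

/-- A point of a level of the first tower has a path of addresses through all the towers. -/
theorem exists_path (hU : IsLevelSystem D U) {f : G} (hf : f ∈ D.F 0) {x : X} (hx : x ∈ U 0 f) :
    ∃ z : ℕ → G, z 0 = f ∧ ∀ m, z m ∈ D.F m ∧ x ∈ U m (z m) ∧ z (m + 1) - z m ∈ D.C m := by
  have hstep : ∀ (m : ℕ) (p : {f : G // f ∈ D.F m ∧ x ∈ U m f}),
      ∃ q : {f : G // f ∈ D.F (m + 1) ∧ x ∈ U (m + 1) f}, q.1 - p.1 ∈ D.C m := by
    rintro m ⟨f, hf, hx⟩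
    obtain ⟨c, hc, hxc⟩ := (hU.split _ _ x).1 hx
    exact ⟨⟨f + c, D.add_mem m f hf c hc, hxc⟩, by simpa using hc⟩
  choose nx hnx using hstep
  let z : (m : ℕ) → {f : G // f ∈ D.F m ∧ x ∈ U m f} := fun m => Nat.rec ⟨f, hf, hx⟩ nx m
  exact ⟨fun m => (z m).1, rfl, fun m => ⟨(z m).2.1, (z m).2.2, hnx m (z m)⟩⟩

/-- By `exists_refine`, a set `U m g` with arbitrary `g` is a countable union of levels of towers.
-/
theorem generate_levels [Countable G] (hU : IsLevelSystem D U) :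
    mX = MeasurableSpace.generateFrom {s | ∃ m, ∃ f ∈ (D.F m : Set G), s = U m f} := by
  apply le_antisymm
  · conv_lhs => rw [hU.generate]
    refine MeasurableSpace.generateFrom_le ?_
    rintro _ ⟨m, g, rfl⟩
    have : U m g = ⋃ p ∈ {p : ℕ × G | p.2 ∈ D.F p.1 ∧ U p.1 p.2 ⊆ U m g}, U p.1 p.2 := by
      apply Set.Subset.antisymm
      · intro x hx
        obtain ⟨M, -, f, hf, hxf, hsub⟩ := hU.exists_refine hx 0
        exact Set.mem_biUnion (x := (M, f)) ⟨hf, hsub⟩ hxf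
      · exact Set.iUnion₂_subset fun p hp => hp.2
    rw [this]
    refine MeasurableSet.biUnion (Set.to_countable _) fun p hp => ?_
    exact MeasurableSpace.measurableSet_generateFrom ⟨p.1, p.2, hp.1, rfl⟩
  · refine MeasurableSpace.generateFrom_le ?_
    rintro _ ⟨m, f, -, rfl⟩
    exact hU.measurableSet m f

theorem measurable_vadd (hU : IsLevelSystem D U) (g : G) : Measurable fun x : X => g +ᵥ x := by
  have : @Measurable X X mX (MeasurableSpace.generateFrom {s | ∃ m f, s = U m f})
      (fun x : X => g +ᵥ x) := by
    refine measurable_generateFrom ?_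
    rintro _ ⟨m, f, rfl⟩
    have : (fun x : X => g +ᵥ x) ⁻¹' U m f = U m (f - g) := by
      ext x
      exact hU.vadd_mem_iff m f g x
    rw [this]
    exact hU.measurableSet _ _
  rwa [← hU.generate] at this

theorem iUnion_split (hU : IsLevelSystem D U) (m : ℕ) (f : G) :
    U m f = ⋃ c ∈ D.C m, U (m + 1) (f + c) := by
  ext x
  simp [hU.split m f x]

theorem disj_split (hU : IsLevelSystem D U) {m : ℕ} (f : G) {c c' : G} (hc : c ∈ D.C m)
    (hc' : c' ∈ D.C m) (hne : c ≠ c') : Disjoint (U (m + 1) (f + c)) (U (m + 1) (f + c')) := by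
  rw [Set.disjoint_left]
  intro x hx hx'
  have h1 := (hU.vadd_mem_iff (m + 1) (0 + c) (-f) x).2 (by simpa [add_comm] using hx)
  have h2 := (hU.vadd_mem_iff (m + 1) (0 + c') (-f) x).2 (by simpa [add_comm] using hx')
  have h0 := D.zero_mem m
  have := hU.disj (m + 1) _ (D.add_mem m 0 h0 c hc) _ (D.add_mem m 0 h0 c' hc') _ h1 h2
  exact hne (by simpa using this)

/-- The measure `μ` gives all levels of the towers their expected mass. -/
def Normalizes (D : CFData G) (U : ℕ → G → Set X) (μ : Measure X) : Prop :=
  ∀ m, ∀ f ∈ D.F m, μ (U m f) = D.weight m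

theorem sigmaFinite [Countable G] (hU : IsLevelSystem D U) {μ : Measure X}
    (hμ : Normalizes D U μ) : SigmaFinite μ := by
  refine Measure.sigmaFinite_of_countable (S := {s | ∃ m, ∃ f ∈ D.F m, s = U m f}) ?_ ?_ ?_
  · refine (Set.countable_range fun p : ℕ × G => U p.1 p.2).mono ?_
    rintro s ⟨m, i, -, rfl⟩
    exact ⟨(m, i), rfl⟩
  · rintro _ ⟨m, f, hf, rfl⟩
    rw [hμ m f hf]
    exact (D.weight_ne_top m).lt_top
  · refine Set.eq_univ_of_forall fun x => ?_
    obtain ⟨N, hN⟩ := hU.exists_mem x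
    obtain ⟨f, hf, hx⟩ := hN N le_rfl
    exact ⟨_, ⟨N, f, hf, rfl⟩, hx⟩

theorem measure_split (hU : IsLevelSystem D U) (μ : Measure X) (m : ℕ) (f : G) :
    μ (U m f) = ∑ c ∈ D.C m, μ (U (m + 1) (f + c)) := by
  rw [hU.iUnion_split m f, measure_biUnion_finset]
  · intro c hc c' hc' hne
    exact hU.disj_split f hc hc' hne
  · intro c _
    exact hU.measurableSet _ _

/-- The mass of an arbitrary translate can be computed in a higher tower. -/
theorem measure_eq_weight (hU : IsLevelSystem D U) {μ : Measure X}
    (hμ : Normalizes D U μ) (m : ℕ) (g : G) : μ (U m g) = D.weight m := by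
  obtain ⟨N, hN⟩ := eventually_atTop.1 (D.absorb g)
  have key : ∀ j m, N ≤ m + j → ∀ d ∈ D.F m, μ (U m (g + d)) = D.weight m := by
    intro j
    induction j with
    | zero =>
      intro m hm d hd
      have : ∀ c ∈ D.C m, μ (U (m + 1) (g + d + c)) = D.weight (m + 1) := fun c hc =>
        hμ _ _ (by rw [add_assoc]; exact hN m hm d hd c hc)
      rw [hU.measure_split, Finset.sum_congr rfl this, Finset.sum_const, nsmul_eq_mul,
        D.weight_succ]
    | succ j ih =>
      intro m hm d hd
      have : ∀ c ∈ D.C m, μ (U (m + 1) (g + d + c)) = D.weight (m + 1) := fun c hc => by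
        rw [add_assoc]
        exact ih (m + 1) (by omega) _ (D.add_mem m d hd c hc)
      rw [hU.measure_split, Finset.sum_congr rfl this, Finset.sum_const, nsmul_eq_mul,
        D.weight_succ]
  simpa using key N m (by omega) 0 (D.zero_mem m)

theorem measurePreserving [Countable G] (hU : IsLevelSystem D U) {μ : Measure X}
    (hμ : Normalizes D U μ) (g : G) : MeasurePreserving (fun x : X => g +ᵥ x) μ μ := by
  refine ⟨hU.measurable_vadd g, ?_⟩
  have hval : ∀ m f, Measure.map (fun x : X => g +ᵥ x) μ (U m f) = D.weight m := by
    intro m f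
    rw [Measure.map_apply (hU.measurable_vadd g) (hU.measurableSet m f)]
    have : (fun x : X => g +ᵥ x) ⁻¹' U m f = U m (f - g) := by
      ext x
      exact hU.vadd_mem_iff m f g x
    rw [this, hU.measure_eq_weight hμ]
  refine Measure.ext_of_nested hU.generate_levels ?_ ?_ ?_ ?_
  · intro m M hM f hf f' hf' hne
    exact hU.nested hM hf hf' hne
  · intro x
    obtain ⟨N, hN⟩ := hU.exists_mem x
    obtain ⟨f, hf, hx⟩ := hN N le_rfl
    exact ⟨N, f, hf, hx⟩
  · intro m f hf
    rw [hval, hμ m f hf]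
  · intro m f hf
    rw [hval]
    exact D.weight_ne_top m

/-- A level system carried by a standard Borel space, with a normalized measure, is an infinite
measure preserving action. -/
theorem isInfiniteMeasurePreserving [Countable G] (hX : StandardBorelSpace X)
    (hU : IsLevelSystem D U) {μ : Measure X} (hμ : Normalizes D U μ) :
    IsInfiniteMeasurePreserving G μ where
  standardBorel := hX
  sigmaFinite := hU.sigmaFinite hμ
  nonatomic x := by
    obtain ⟨N, hN⟩ := hU.exists_mem x
    have hle : ∀ᶠ M in atTop, μ {x} ≤ (2⁻¹ : ℝ≥0∞) ^ M := by
      filter_upwards [eventually_ge_atTop N] with M hM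
      obtain ⟨f, hf, hx⟩ := hN M hM
      calc μ {x} ≤ μ (U M f) := measure_mono (by simpa using hx)
        _ = D.weight M := hμ M f hf
        _ ≤ _ := D.weight_le M
    have hlim := ENNReal.tendsto_pow_atTop_nhds_zero_of_lt_one (r := 2⁻¹) (by simp)
    exact le_antisymm (ge_of_tendsto hlim hle) bot_le
  infinite := by
    have hle : ∀ m : ℕ, (2 : ℝ≥0∞) ^ m ≤ μ Set.univ := by
      intro m
      calc (2 : ℝ≥0∞) ^ m ≤ (D.F m).card * D.weight m := D.two_pow_le m
        _ = ∑ f ∈ D.F m, μ (U m f) := by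
          rw [Finset.sum_congr rfl (hμ m), Finset.sum_const, nsmul_eq_mul]
        _ = μ (⋃ f ∈ D.F m, U m f) := by
          rw [measure_biUnion_finset]
          · intro f hf f' hf' hne
            exact Set.disjoint_left.2 fun x hx hx' => hne (hU.disj m f hf f' hf' x hx hx')
          · exact fun f _ => hU.measurableSet m f
        _ ≤ μ Set.univ := measure_mono (Set.subset_univ _)
    have hlim := ENNReal.tendsto_pow_atTop_nhds_top_iff (r := 2) |>.2 (by norm_num)
    exact top_le_iff.1 (le_of_tendsto' hlim hle)
  measurePreserving g := hU.measurePreserving hμ g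

end IsLevelSystem

/-! ### The model of the action on a standard Borel space. -/

namespace CFData

variable {G : Type*} [AddCommGroup G] (D : CFData G) (e : G ≃ ℕ)

/-- A sequence records the sets `U m f` that contain a point. -/
def carrier : Set (ℕ → ℕ → Prop) :=
  -- Coding `G` by `ℕ` keeps the space in `Type` for every universe of `G`. Disjointness is imposed
  -- on all translates `g + F m`, which makes the set stable under the action.
  {x | (∃ m i, x m i) ∧
    (∀ m, ∀ g : G, ∀ f ∈ D.F m, ∀ f' ∈ D.F m, x m (e (g + f)) → x m (e (g + f')) → f = f') ∧
    ∀ m, ∀ f : G, x m (e f) ↔ ∃ c ∈ D.C m, x (m + 1) (e (f + c))}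

theorem measurableSet_carrier : MeasurableSet (D.carrier e) := by
  have : Countable G := e.countable_iff.2 inferInstance
  have h : ∀ m i, Measurable fun x : ℕ → ℕ → Prop => x m i := fun m i =>
    (measurable_pi_apply i).comp (measurable_pi_apply m)
  refine measurableSet_setOfPred.2 (Measurable.and ?_ (Measurable.and ?_ ?_))
  · exact Measurable.exists fun m => Measurable.exists fun i => h m i
  · exact Measurable.forall fun m => Measurable.forall fun g => Measurable.forall fun f =>
      Measurable.imp measurable_const <| Measurable.forall fun f' =>
        Measurable.imp measurable_const <| (h _ _).imp <| (h _ _).imp measurable_const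
  · exact Measurable.forall fun m => Measurable.forall fun f => (h _ _).iff <|
      Measurable.exists fun c => Measurable.and measurable_const (h _ _)

/-- The space of the `(C,F)`-action. -/
def Space : Type := D.carrier e

instance : MeasurableSpace (D.Space e) := inferInstanceAs (MeasurableSpace (D.carrier e))

instance : StandardBorelSpace (D.Space e) := (D.measurableSet_carrier e).standardBorel

/-- The `(C,F)`-action by translations. -/
@[reducible] def spaceAction : AddAction G (D.Space e) where
  vadd g x := ⟨fun m i => x.1 m (e (-g + e.symm i)), by
    obtain ⟨⟨m, i, h1⟩, h2, h3⟩ := x.2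
    refine ⟨⟨m, e (g + e.symm i), by simpa using h1⟩, ?_, ?_⟩
    · intro m g' f hf f' hf' h h'
      refine h2 m (-g + g') f hf f' hf' ?_ ?_
      · simpa [add_assoc] using h
      · simpa [add_assoc] using h'
    · intro m f
      simp only [Equiv.symm_apply_apply, h3 m, add_assoc]⟩
  zero_vadd x := Subtype.ext <| by
    funext m i
    change x.1 m (e (-0 + e.symm i)) = x.1 m i
    simp
  add_vadd g h x := Subtype.ext <| by
    funext m i
    change x.1 m (e (-(g + h) + e.symm i)) = x.1 m (e (-h + e.symm (e (-g + e.symm i))))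
    rw [Equiv.symm_apply_apply, ← add_assoc, neg_add_rev]

/-- The sets `T_f A_m` of the `(C,F)`-action. -/
def level (m : ℕ) (f : G) : Set (D.Space e) := {x | x.1 m (e f)}

theorem isLevelSystem :
    @IsLevelSystem G (D.Space e) _ _ (D.spaceAction e) D (D.level e) := by
  let _ := D.spaceAction e
  refine ⟨?_, ?_, ?_, ?_, ?_⟩
  · apply le_antisymm
    · have h : @Measurable (D.Space e) _
          (MeasurableSpace.generateFrom {s | ∃ m f, s = D.level e m f}) _ Subtype.val := by
        let _ : MeasurableSpace (D.Space e) :=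
          MeasurableSpace.generateFrom {s | ∃ m f, s = D.level e m f}
        refine measurable_pi_iff.2 fun m => measurable_pi_iff.2 fun i => ?_
        refine measurableSet_setOfPred.1 ?_
        exact MeasurableSpace.measurableSet_generateFrom ⟨m, e.symm i, by
          ext x; simp [level]⟩
      exact h.comap_le
    · refine MeasurableSpace.generateFrom_le ?_
      rintro _ ⟨m, f, rfl⟩
      exact measurableSet_setOfPred.2 ((measurable_pi_apply (e f)).comp
        ((measurable_pi_apply m).comp measurable_subtype_coe))
  · intro m f g x
    change x.1 m (e (-g + e.symm (e (g + f)))) ↔ x.1 m (e f)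
    simp
  · intro m f hf f' hf' x hx hx'
    exact x.2.2.1 m 0 f hf f' hf' (by simpa [level] using hx) (by simpa [level] using hx')
  · intro m f x
    exact x.2.2.2 m f
  · intro x
    obtain ⟨m, i, h⟩ := x.2.1
    exact ⟨m, e.symm i, by simpa [level] using h⟩

/-! ### The invariant measure, built from independent uniform choices. -/

/-- The `j`-th cutting choice. -/
abbrev Choice (j : ℕ) : Type _ := D.C j

instance (j : ℕ) : MeasurableSpace (D.Choice j) := ⊤

instance (j : ℕ) : DiscreteMeasurableSpace (D.Choice j) := ⟨fun _ => trivial⟩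

instance (j : ℕ) : Nonempty (D.Choice j) :=
  (Finset.card_pos.1 (D.card_pos j)).to_subtype

variable {D}

/-- The sum of the choices with indices in `[n, M)`. -/
def pathSum (y : ∀ j, D.Choice j) (n M : ℕ) : G := ∑ j ∈ Finset.Ico n M, ((y j).1 : G)

theorem pathSum_self (y : ∀ j, D.Choice j) (n : ℕ) : pathSum y n n = 0 := by simp [pathSum]

theorem pathSum_succ (y : ∀ j, D.Choice j) {n M : ℕ} (h : n ≤ M) :
    pathSum y n (M + 1) = pathSum y n M + (y M).1 := Finset.sum_Ico_succ_top h _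

theorem pathSum_add (y : ∀ j, D.Choice j) {n m M : ℕ} (h : n ≤ m) (h' : m ≤ M) :
    pathSum y n m + pathSum y m M = pathSum y n M := Finset.sum_Ico_consecutive _ h h'

theorem pathSum_congr {y y' : ∀ j, D.Choice j} {n M : ℕ} (h : ∀ j, n ≤ j → j < M → y j = y' j) :
    pathSum y n M = pathSum y' n M :=
  Finset.sum_congr rfl fun j hj => by rw [h j (Finset.mem_Ico.1 hj).1 (Finset.mem_Ico.1 hj).2]

theorem add_pathSum_mem (y : ∀ j, D.Choice j) {m M : ℕ} (h : m ≤ M) {f : G} (hf : f ∈ D.F m) :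
    f + pathSum y m M ∈ D.F M := by
  induction M, h using Nat.le_induction with
  | base => simpa [pathSum_self] using hf
  | succ M h ih =>
    rw [pathSum_succ y h, ← add_assoc]
    exact D.add_mem M _ ih _ (y M).2

theorem pathSum_injective {y y' : ∀ j, D.Choice j} {m M : ℕ} (h : m ≤ M) {f f' : G}
    (hf : f ∈ D.F m) (hf' : f' ∈ D.F m) (heq : f + pathSum y m M = f' + pathSum y' m M) :
    f = f' ∧ ∀ j, m ≤ j → j < M → y j = y' j := by
  induction M, h using Nat.le_induction with
  | base => exact ⟨by simpa [pathSum_self] using heq, fun j h1 h2 => by omega⟩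
  | succ M h ih =>
    rw [pathSum_succ y h, pathSum_succ y' h, ← add_assoc, ← add_assoc] at heq
    have hc := D.add_inj M _ (add_pathSum_mem y h hf) _ (add_pathSum_mem y' h hf') _ (y M).2 _
      (y' M).2 heq
    rw [hc] at heq
    obtain ⟨h1, h2⟩ := ih (add_right_cancel heq)
    refine ⟨h1, fun j hj hj' => ?_⟩
    rcases Nat.lt_succ_iff_lt_or_eq.1 hj' with h' | rfl
    · exact h2 j hj h'
    · exact Subtype.ext hc

/-- `g` at stage `m` and `f` at stage `n`, continued by the choices `y`, end up in the same place. -/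
def Joins (n : ℕ) (f : G) (y : ∀ j, D.Choice j) (m : ℕ) (g : G) (M : ℕ) : Prop :=
  m ≤ M ∧ n ≤ M ∧ ∃ c : ∀ j, D.Choice j, f + pathSum y n M = g + pathSum c m M

theorem Joins.mono {n : ℕ} {f : G} {y : ∀ j, D.Choice j} {m : ℕ} {g : G} {M M' : ℕ}
    (h : Joins n f y m g M) (hM : M ≤ M') : Joins n f y m g M' := by
  obtain ⟨h1, h2, c, hc⟩ := h
  refine ⟨h1.trans hM, h2.trans hM, fun j => if j < M then c j else y j, ?_⟩
  rw [← pathSum_add y h2 hM, ← pathSum_add _ h1 hM, ← add_assoc, hc, add_assoc]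
  congr 2
  · exact pathSum_congr fun j _ hj => by simp [hj]
  · exact pathSum_congr fun j hj _ => by simp [not_lt.2 hj]

variable (D)

/-- The point with address `f` at stage `n` and subsequent choices `y`. -/
def point (n : ℕ) (f : G) (y : ∀ j, D.Choice j) : D.Space e :=
  ⟨fun m i => ∃ M, Joins n f y m (e.symm i) M, by
    classical
    refine ⟨⟨n, e f, n, le_rfl, le_rfl, y, by simp⟩, ?_, ?_⟩
    · rintro m g f₁ h₁ f₂ h₂ ⟨M₁, hM₁⟩ ⟨M₂, hM₂⟩
      -- Both joins are continued to a common stage, where sums decompose uniquely.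
      obtain ⟨hm, -, c₁, hc₁⟩ := hM₁.mono (le_max_left M₁ M₂)
      obtain ⟨-, -, c₂, hc₂⟩ := hM₂.mono (le_max_right M₁ M₂)
      rw [Equiv.symm_apply_apply, add_assoc] at hc₁ hc₂
      exact (pathSum_injective hm h₁ h₂ (add_left_cancel (hc₁.symm.trans hc₂))).1
    · intro m g
      constructor
      · rintro ⟨M, hM⟩
        obtain ⟨hm, hn, c, hc⟩ := hM.mono M.le_succ
        obtain ⟨hm', -⟩ := hM
        refine ⟨c m, (c m).2, M + 1, by omega, hn, c, ?_⟩
        rw [Equiv.symm_apply_apply] at hc ⊢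
        rw [hc, ← pathSum_add c m.le_succ (by omega : m + 1 ≤ M + 1), pathSum_succ c le_rfl,
          pathSum_self, zero_add, add_assoc]
      · rintro ⟨c₀, hc₀, M, hm, hn, c, hc⟩
        refine ⟨M, by omega, hn, Function.update c m ⟨c₀, hc₀⟩, ?_⟩
        rw [Equiv.symm_apply_apply] at hc ⊢
        rw [hc, ← pathSum_add _ m.le_succ hm, pathSum_succ _ le_rfl, pathSum_self, zero_add,
          Function.update_self, add_assoc]
        congr 2
        exact pathSum_congr fun j hj _ => by rw [Function.update_of_ne (by omega)]⟩

theorem point_mem_level_iff {n m : ℕ} (hnm : n ≤ m) {f f' : G} (hf : f ∈ D.F n) (hf' : f' ∈ D.F m)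
    (y : ∀ j, D.Choice j) : D.point e n f y ∈ D.level e m f' ↔ f + pathSum y n m = f' := by
  constructor
  · rintro ⟨M, hm, hn, c, hc⟩
    rw [Equiv.symm_apply_apply, ← pathSum_add y hnm hm, ← add_assoc] at hc
    exact (pathSum_injective hm (add_pathSum_mem y hnm hf) hf' hc).1
  · intro h
    exact ⟨m, le_rfl, hnm, y, by rw [Equiv.symm_apply_apply, h, pathSum_self, add_zero]⟩

theorem measurableSet_pathSum {n M : ℕ} (h : n ≤ M) (P : G → Prop) :
    MeasurableSet {y : ∀ j, D.Choice j | P (pathSum y n M)} := by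
  induction M, h using Nat.le_induction generalizing P with
  | base => simp [pathSum_self]
  | succ M h ih =>
    have : {y : ∀ j, D.Choice j | P (pathSum y n (M + 1))} =
        ⋃ c : D.Choice M, {y | y M = c} ∩ {y | P (pathSum y n M + c.1)} := by
      ext y
      simp [pathSum_succ y h]
    rw [this]
    refine MeasurableSet.iUnion fun c => MeasurableSet.inter ?_ (ih fun g => P (g + c.1))
    exact (measurable_pi_apply M) (MeasurableSet.singleton c)

theorem measurable_point (n : ℕ) (f : G) : Measurable (D.point e n f) := by
  refine Measurable.subtype_mk (measurable_pi_iff.2 fun m => measurable_pi_iff.2 fun i => ?_)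
  refine Measurable.exists fun M => Measurable.and measurable_const ?_
  by_cases hn : n ≤ M
  · refine Measurable.and measurable_const (measurableSet_setOfPred.1 ?_)
    exact D.measurableSet_pathSum hn fun g => ∃ c : ∀ j, D.Choice j, f + g = _ + pathSum c m M
  · simp [hn]

/-- The product of the uniform distributions on the sets `C j`. -/
noncomputable def pathMeasure : Measure (∀ j, D.Choice j) :=
  Measure.infinitePi fun j => ProbabilityTheory.uniformOn (Set.univ : Set (D.Choice j))

/-- Sums decompose uniquely, so the event is the cylinder that fixes the choices with indices in
`[n, m)`. -/
theorem pathMeasure_point {n m : ℕ} (hnm : n ≤ m) {f : G} (hf : f ∈ D.F n)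
    (c : ∀ j, D.Choice j) :
    D.pathMeasure {y | D.point e n f y ∈ D.level e m (f + pathSum c n m)} =
      ∏ j ∈ Finset.Ico n m, ((D.C j).card : ℝ≥0∞)⁻¹ := by
  have : {y | D.point e n f y ∈ D.level e m (f + pathSum c n m)} =
      Set.pi (Finset.Ico n m : Set ℕ) fun j => {c j} := by
    ext y
    rw [Set.mem_ofPred_eq, D.point_mem_level_iff e hnm hf (add_pathSum_mem c hnm hf)]
    simp only [Set.mem_pi, Finset.coe_Ico, Set.mem_Ico, Set.mem_singleton_iff, and_imp]
    exact ⟨fun h => (pathSum_injective hnm hf hf h).2, fun h => by rw [pathSum_congr h]⟩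
  rw [this, pathMeasure, Measure.infinitePi_pi _ fun j _ => MeasurableSet.singleton _]
  refine Finset.prod_congr rfl fun j _ => ?_
  rw [ProbabilityTheory.uniformOn_univ, Measure.count_singleton, one_div]
  congr 2
  exact Fintype.card_coe (D.C j)

open Classical in
/-- The addresses at stage `n` that do not come from an earlier stage. -/
noncomputable def roots (n : ℕ) : Finset G :=
  (D.F n).filter fun f => ∀ j, j + 1 = n → ∀ f' ∈ D.F j, ∀ c ∈ D.C j, f ≠ f' + c

theorem mem_roots {n : ℕ} {f : G} : f ∈ D.roots n ↔
    f ∈ D.F n ∧ ∀ j, j + 1 = n → ∀ f' ∈ D.F j, ∀ c ∈ D.C j, f ≠ f' + c := by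
  simp only [roots, Finset.mem_filter]

theorem exists_root {m : ℕ} {f' : G} (hf' : f' ∈ D.F m) :
    ∃ n ≤ m, ∃ f ∈ D.roots n, ∃ c : ∀ j, D.Choice j, f + pathSum c n m = f' := by
  classical
  induction m generalizing f' with
  | zero =>
    refine ⟨0, le_rfl, f', D.mem_roots.2 ⟨hf', fun j hj => by omega⟩,
      fun j => Classical.arbitrary _, by rw [pathSum_self, add_zero]⟩
  | succ m ih =>
    by_cases h : f' ∈ D.roots (m + 1)
    · exact ⟨m + 1, le_rfl, f', h, fun j => Classical.arbitrary _, by rw [pathSum_self, add_zero]⟩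
    · simp only [mem_roots, hf', true_and] at h
      push Not at h
      obtain ⟨j, hj, f₁, hf₁, c₀, hc₀, rfl⟩ := h
      obtain rfl : j = m := by omega
      obtain ⟨n, hn, f, hf, c, hc⟩ := ih hf₁
      refine ⟨n, by omega, f, hf, Function.update c j ⟨c₀, hc₀⟩, ?_⟩
      rw [pathSum_succ _ hn, Function.update_self, ← add_assoc, ← hc]
      congr 2
      exact pathSum_congr fun i _ hi => by rw [Function.update_of_ne (by omega)]

/-- Roots mark the stage at which a point enters the towers, so root levels are disjoint and the
measure can be defined separately on each of them. -/
theorem root_unique {X : Type*} [MeasurableSpace X] [AddAction G X] {D : CFData G}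
    {U : ℕ → G → Set X} (hU : IsLevelSystem D U) {n n' : ℕ} {f f' : G} {x : X}
    (hf : f ∈ D.roots n) (hx : x ∈ U n f) (hf' : f' ∈ D.roots n') (hx' : x ∈ U n' f') :
    n = n' ∧ f = f' := by
  have key : ∀ {n n' : ℕ} {f f' : G}, f ∈ D.roots n → x ∈ U n f → f' ∈ D.roots n' →
      x ∈ U n' f' → ¬ n < n' := by
    intro n n' f f' hf hx hf' hx' hlt
    obtain ⟨j, rfl⟩ : ∃ j, n' = j + 1 := ⟨n' - 1, by omega⟩
    obtain ⟨f₁, hf₁, hx₁⟩ := hU.exists_mem_of_le (by omega : n ≤ j) (D.mem_roots.1 hf).1 hx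
    obtain ⟨c, hc, hxc⟩ := (hU.split j f₁ x).1 hx₁
    refine (D.mem_roots.1 hf').2 j rfl f₁ hf₁ c hc ?_
    exact hU.disj _ _ (D.mem_roots.1 hf').1 _ (D.add_mem j f₁ hf₁ c hc) x hx' hxc
  obtain rfl : n = n' := le_antisymm (not_lt.1 (key hf' hx' hf hx)) (not_lt.1 (key hf hx hf' hx'))
  exact ⟨rfl, hU.disj n _ (D.mem_roots.1 hf).1 _ (D.mem_roots.1 hf').1 x hx hx'⟩

/-- The measure of the `(C,F)`-action. -/
noncomputable def spaceMeasure : Measure (D.Space e) :=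
  Measure.sum fun n => ∑ f ∈ D.roots n, D.weight n • D.pathMeasure.map (D.point e n f)

theorem normalizes_spaceMeasure :
    IsLevelSystem.Normalizes D (D.level e) (D.spaceMeasure e) := by
  let _ := D.spaceAction e
  have hU := D.isLevelSystem e
  intro m f' hf'
  obtain ⟨n, hnm, f, hf, c, rfl⟩ := D.exists_root hf'
  have hfn := (D.mem_roots.1 hf).1
  have hterm : ∀ n₁, ∀ f₁ ∈ D.roots n₁, (D.weight n₁ • D.pathMeasure.map (D.point e n₁ f₁))
      (D.level e m (f + pathSum c n m)) =
      D.weight n₁ * D.pathMeasure {y | D.point e n₁ f₁ y ∈ D.level e m (f + pathSum c n m)} := by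
    intro n₁ f₁ _
    rw [Measure.smul_apply, Measure.map_apply (D.measurable_point e n₁ f₁)
      (hU.measurableSet _ _), smul_eq_mul]
    rfl
  -- The level lies inside the root level `(n, f)`, so every other summand gives it no mass.
  have hzero : ∀ n₁, ∀ f₁ ∈ D.roots n₁, (n₁, f₁) ≠ (n, f) →
      D.pathMeasure {y | D.point e n₁ f₁ y ∈ D.level e m (f + pathSum c n m)} = 0 := by
    intro n₁ f₁ hf₁ hne
    convert measure_empty (μ := D.pathMeasure)
    refine Set.eq_empty_of_forall_notMem fun y hy => hne ?_
    have hx₁ : D.point e n₁ f₁ y ∈ D.level e n₁ f₁ :=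
      (D.point_mem_level_iff e le_rfl (D.mem_roots.1 hf₁).1 (D.mem_roots.1 hf₁).1 y).2
        (by rw [pathSum_self, add_zero])
    have hx : D.point e n₁ f₁ y ∈ D.level e n f := by
      refine hU.nested hnm hfn hf' ⟨D.point e n f c, ?_, ?_⟩ hy
      · exact (D.point_mem_level_iff e le_rfl hfn hfn c).2 (by rw [pathSum_self, add_zero])
      · exact (D.point_mem_level_iff e hnm hfn hf' c).2 rfl
    obtain ⟨rfl, rfl⟩ := root_unique hU hf₁ hx₁ hf hx
    rfl
  rw [spaceMeasure, Measure.sum_apply _ (hU.measurableSet _ _), tsum_eq_single n,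
    Measure.finsetSum_apply, Finset.sum_eq_single f, hterm n f hf, D.pathMeasure_point e hnm hfn]
  · exact Finset.prod_range_mul_prod_Ico _ hnm
  · intro f₁ hf₁ hne
    rw [hterm n f₁ hf₁, hzero n f₁ hf₁ (by simpa using hne), mul_zero]
  · exact fun h => (h hf).elim
  · intro n₁ hne
    rw [Measure.finsetSum_apply]
    refine Finset.sum_eq_zero fun f₁ hf₁ => ?_
    rw [hterm n₁ f₁ hf₁, hzero n₁ f₁ hf₁ (by simp [hne]), mul_zero]

end CFData

/-! ### Approximation by unions of levels: funny rank one and rigidity. -/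

namespace IsLevelSystem

section

variable {G X : Type*} [AddCommGroup G] {D : CFData G} {U : ℕ → G → Set X}

/-- The finite unions of levels of the `m`-th tower. -/
def levelUnions (D : CFData G) (U : ℕ → G → Set X) (m : ℕ) : Set (Set X) :=
  {A | ∃ S ⊆ D.F m, A = ⋃ g ∈ S, U m g}

theorem mem_levelUnions_union {m : ℕ} {A B : Set X} (hA : A ∈ levelUnions D U m)
    (hB : B ∈ levelUnions D U m) : A ∪ B ∈ levelUnions D U m := by
  classical
  obtain ⟨S, hS, rfl⟩ := hA
  obtain ⟨S', hS', rfl⟩ := hB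
  exact ⟨S ∪ S', Finset.union_subset hS hS', by rw [Finset.set_biUnion_union]⟩

/-- The union of the `m`-th tower. -/
def tower (D : CFData G) (U : ℕ → G → Set X) (m : ℕ) : Set X := ⋃ g ∈ D.F m, U m g

theorem tower_mem (m : ℕ) : tower D U m ∈ levelUnions D U m := ⟨D.F m, subset_rfl, rfl⟩

end

variable {G X : Type*} [AddCommGroup G] [mX : MeasurableSpace X] [AddAction G X]
  {D : CFData G} {U : ℕ → G → Set X}

theorem levelUnions_mono (hU : IsLevelSystem D U) {m M : ℕ} (h : m ≤ M) :
    levelUnions D U m ⊆ levelUnions D U M := by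
  classical
  induction M, h using Nat.le_induction with
  | base => exact subset_rfl
  | succ M _ ih =>
    refine ih.trans ?_
    rintro _ ⟨S, hS, rfl⟩
    refine ⟨(S ×ˢ D.C M).image fun p => p.1 + p.2, ?_, ?_⟩
    · intro x hx
      obtain ⟨⟨f, c⟩, hp, rfl⟩ := Finset.mem_image.1 hx
      obtain ⟨hf, hc⟩ := Finset.mem_product.1 hp
      exact D.add_mem M f (hS hf) c hc
    · ext x
      simp only [Set.mem_iUnion, exists_prop, Finset.mem_image, Finset.mem_product, Prod.exists,
        hU.split M]
      constructor
      · rintro ⟨f, hf, c, hc, hx⟩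
        exact ⟨_, ⟨f, c, ⟨hf, hc⟩, rfl⟩, hx⟩
      · rintro ⟨_, ⟨f, c, ⟨hf, hc⟩, rfl⟩, hx⟩
        exact ⟨f, hf, c, hc, hx⟩

theorem mem_levelUnions_diff (hU : IsLevelSystem D U) {m : ℕ} {A B : Set X}
    (hA : A ∈ levelUnions D U m) (hB : B ∈ levelUnions D U m) : A \ B ∈ levelUnions D U m := by
  classical
  obtain ⟨S, hS, rfl⟩ := hA
  obtain ⟨S', hS', rfl⟩ := hB
  refine ⟨S \ S', Finset.sdiff_subset.trans hS, ?_⟩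
  ext x
  simp only [Set.mem_sdiff, Set.mem_iUnion, exists_prop, Finset.mem_sdiff, not_exists, not_and]
  constructor
  · rintro ⟨⟨f, hf, hx⟩, h⟩
    exact ⟨f, ⟨hf, fun hf' => h f hf' hx⟩, hx⟩
  · rintro ⟨f, ⟨hf, hf'⟩, hx⟩
    refine ⟨⟨f, hf, hx⟩, fun f₁ hf₁ hx₁ => hf' ?_⟩
    rwa [hU.disj m f (hS hf) f₁ (hS' hf₁) x hx hx₁]

theorem isSetRing_levelUnions (hU : IsLevelSystem D U) :
    IsSetRing (⋃ m, levelUnions D U m) where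
  empty_mem := Set.mem_iUnion.2 ⟨0, ∅, Finset.empty_subset _, by simp⟩
  union_mem s t hs ht := by
    obtain ⟨m, hs⟩ := Set.mem_iUnion.1 hs
    obtain ⟨n, ht⟩ := Set.mem_iUnion.1 ht
    exact Set.mem_iUnion.2 ⟨max m n, mem_levelUnions_union
      (hU.levelUnions_mono (le_max_left m n) hs) (hU.levelUnions_mono (le_max_right m n) ht)⟩
  sdiff_mem s t hs ht := by
    obtain ⟨m, hs⟩ := Set.mem_iUnion.1 hs
    obtain ⟨n, ht⟩ := Set.mem_iUnion.1 ht
    exact Set.mem_iUnion.2 ⟨max m n, hU.mem_levelUnions_diff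
      (hU.levelUnions_mono (le_max_left m n) hs) (hU.levelUnions_mono (le_max_right m n) ht)⟩

theorem monotone_tower (hU : IsLevelSystem D U) : Monotone (tower D U) := by
  intro m M h x hx
  simp only [tower, Set.mem_iUnion, exists_prop] at hx ⊢
  obtain ⟨f, hf, hx⟩ := hx
  exact hU.exists_mem_of_le h hf hx

theorem iUnion_tower (hU : IsLevelSystem D U) : ⋃ m, tower D U m = Set.univ := by
  refine Set.eq_univ_of_forall fun x => ?_
  obtain ⟨N, hN⟩ := hU.exists_mem x
  obtain ⟨f, hf, hx⟩ := hN N le_rfl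
  exact Set.mem_iUnion.2 ⟨N, Set.mem_biUnion hf hx⟩

theorem measurableSet_biUnion (hU : IsLevelSystem D U) (m : ℕ) (S : Finset G) :
    MeasurableSet (⋃ g ∈ S, U m g) :=
  Finset.measurableSet_biUnion _ fun g _ => hU.measurableSet m g

theorem measure_biUnion (hU : IsLevelSystem D U) {μ : Measure X} (hμ : Normalizes D U μ) {m : ℕ}
    {S : Finset G} (hS : S ⊆ D.F m) : μ (⋃ g ∈ S, U m g) = S.card * D.weight m := by
  rw [measure_biUnion_finset, Finset.sum_congr rfl fun f hf => hμ m f (hS hf), Finset.sum_const,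
    nsmul_eq_mul]
  · intro f hf f' hf' hne
    exact Set.disjoint_left.2 fun x hx hx' => hne (hU.disj m f (hS hf) f' (hS hf') x hx hx')
  · exact fun f _ => hU.measurableSet m f

/-- Sets of finite measure are approximated by unions of levels. -/
theorem exists_approx [Countable G] (hU : IsLevelSystem D U) {μ : Measure X}
    (hμ : Normalizes D U μ) {B : Set X} (hB : MeasurableSet B) (hBfin : μ B ≠ ⊤) {ε : ℝ≥0∞}
    (hε : 0 < ε) : ∃ N, ∀ m ≥ N, ∃ S ⊆ D.F m, μ (symmDiff B (⋃ g ∈ S, U m g)) < ε := by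
  have hε2 := ENNReal.half_pos hε.ne'
  have hT : ∀ N, MeasurableSet (tower D U N) := fun N => hU.measurableSet_biUnion N _
  obtain ⟨N, hN⟩ : ∃ N, μ (B \ tower D U N) < ε / 2 := by
    have h1 : Tendsto (fun N => μ (B \ tower D U N)) atTop (𝓝 (μ (⋂ N, B \ tower D U N))) := by
      refine tendsto_measure_iInter_atTop (fun N => (hB.diff (hT N)).nullMeasurableSet) ?_ ?_
      · exact fun m M h => Set.sdiff_subset_sdiff_right (hU.monotone_tower h)
      · exact ⟨0, measure_ne_top_of_subset Set.sdiff_subset hBfin⟩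
    rw [← Set.sdiff_iUnion, hU.iUnion_tower, Set.sdiff_univ, measure_empty] at h1
    exact (h1.eventually_lt_const hε2).exists
  -- Approximation from the generating ring is applied to a finite measure, the restriction to a
  -- tower containing most of `B`.
  have : IsFiniteMeasure (μ.restrict (tower D U N)) := by
    refine ⟨?_⟩
    rw [Measure.restrict_apply_univ, tower, hU.measure_biUnion hμ subset_rfl]
    exact ENNReal.mul_lt_top (ENNReal.natCast_lt_top _) (D.weight_ne_top N).lt_top
  have hgen : mX = MeasurableSpace.generateFrom (⋃ m, levelUnions D U m) := by
    apply le_antisymm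
    · conv_lhs => rw [hU.generate_levels]
      refine MeasurableSpace.generateFrom_mono ?_
      rintro _ ⟨m, f, hf, rfl⟩
      exact Set.mem_iUnion.2 ⟨m, {f}, by simpa using hf, by simp⟩
    · refine MeasurableSpace.generateFrom_le fun s hs => ?_
      obtain ⟨m, S, -, rfl⟩ := Set.mem_iUnion.1 hs
      exact hU.measurableSet_biUnion m S
  obtain ⟨t, ht, htB⟩ := exists_measure_symmDiff_lt_of_generateFrom_isSetRing
    (μ := μ.restrict (tower D U N)) hU.isSetRing_levelUnions
    ⟨Set.range (tower D U), Set.countable_range _, by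
      rintro _ ⟨m, rfl⟩
      exact Set.mem_iUnion.2 ⟨m, tower_mem m⟩, by
      rw [Set.sUnion_range, hU.iUnion_tower, Set.compl_univ, measure_empty]⟩ hgen hB hε2
  obtain ⟨m₀, ht⟩ := Set.mem_iUnion.1 ht
  have htm : MeasurableSet t := by
    obtain ⟨S, -, rfl⟩ := ht
    exact hU.measurableSet_biUnion m₀ S
  rw [Measure.restrict_apply ((htm.symmDiff hB))] at htB
  refine ⟨max m₀ N, fun m hm => ?_⟩
  have hT' := hU.levelUnions_mono ((le_max_right m₀ N).trans hm) (tower_mem (D := D) (U := U) N)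
  have ht' := hU.levelUnions_mono ((le_max_left m₀ N).trans hm) ht
  -- The double difference is the intersection of `t` with the tower.
  have hmem := hU.mem_levelUnions_diff ht' (hU.mem_levelUnions_diff ht' hT')
  obtain ⟨S, hS, hSeq⟩ := hmem
  refine ⟨S, hS, ?_⟩
  rw [← hSeq]
  calc μ (symmDiff B (t \ (t \ tower D U N)))
      ≤ μ ((B \ tower D U N) ∪ (symmDiff t B ∩ tower D U N)) := by
        refine measure_mono fun x hx => ?_
        simp only [Set.mem_symmDiff, Set.mem_union, Set.mem_inter_iff, Set.mem_sdiff] at hx ⊢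
        tauto
    _ ≤ μ (B \ tower D U N) + μ (symmDiff t B ∩ tower D U N) := measure_union_le _ _
    _ < ε / 2 + ε / 2 := ENNReal.add_lt_add hN htB
    _ = ε := ENNReal.add_halves ε

theorem isFunnyRankOneAlong [Countable G] (hU : IsLevelSystem D U) {μ : Measure X}
    (hμ : Normalizes D U μ) : IsFunnyRankOneAlong μ D.F := by
  have himage : ∀ n g, (fun x : X => g +ᵥ x) '' U n 0 = U n g := fun n g => by
    rw [hU.image_vadd, add_zero]
  refine ⟨fun n => U n 0, fun n => ⟨hU.measurableSet n 0, ?_⟩, fun n g hg h hh hne => ?_,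
    fun B hB hBfin => ?_⟩
  · rw [hU.measure_eq_weight hμ]
    exact D.weight_ne_top n
  · simp only [himage]
    exact Set.disjoint_left.2 fun x hx hx' => hne (hU.disj n g hg h hh x hx hx')
  -- An optimal approximation at each stage gives one sequence that serves every `ε`.
  · have hmin : ∀ n, ∃ S ∈ (D.F n).powerset, ∀ S' ∈ (D.F n).powerset,
        μ (symmDiff B (⋃ g ∈ S, U n g)) ≤ μ (symmDiff B (⋃ g ∈ S', U n g)) := fun n =>
      Finset.exists_min_image _ _ ⟨∅, Finset.empty_mem_powerset _⟩
    choose S hS hSmin using hmin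
    refine ⟨S, fun n => Finset.mem_powerset.1 (hS n), ?_⟩
    simp only [himage]
    refine ENNReal.tendsto_nhds_zero.2 fun ε hε => ?_
    obtain ⟨N, hN⟩ := hU.exists_approx hμ hB hBfin hε
    filter_upwards [eventually_ge_atTop N] with n hn
    obtain ⟨S', hS', hlt⟩ := hN n hn
    exact (hSmin n S' (Finset.mem_powerset.2 hS')).trans hlt.le

theorem measure_image_vadd [Countable G] (hU : IsLevelSystem D U) {μ : Measure X}
    (hμ : Normalizes D U μ) (g : G) {A : Set X} (hA : MeasurableSet A) :
    μ ((fun x => g +ᵥ x) '' A) = μ A := by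
  have : (fun x : X => g +ᵥ x) '' A = (fun x => -g +ᵥ x) ⁻¹' A := by
    ext x
    constructor
    · rintro ⟨y, hy, rfl⟩
      simpa using hy
    · intro hx
      exact ⟨-g +ᵥ x, hx, vadd_neg_vadd g x⟩
  rw [this, (hU.measurePreserving hμ (-g)).measure_preimage hA.nullMeasurableSet]

open Classical in
/-- A union of levels is almost invariant under a translation that almost preserves `C m`. -/
theorem measure_diff_image_le [Countable G] (hU : IsLevelSystem D U) {μ : Measure X}
    (hμ : Normalizes D U μ) {m : ℕ} {S : Finset G} (hS : S ⊆ D.F m) (h : G) (n : ℕ)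
    (hn : (n + 1) * ((D.C m).filter fun c => c - h ∉ D.C m).card ≤ (D.C m).card) :
    ((n : ℝ≥0∞) + 1) * μ ((⋃ g ∈ S, U m g) \ (fun x => h +ᵥ x) '' ⋃ g ∈ S, U m g) ≤
      μ (⋃ g ∈ S, U m g) := by
  set Q := (D.C m).filter fun c => c - h ∉ D.C m
  have hsub : (⋃ g ∈ S, U m g) \ (fun x => h +ᵥ x) '' (⋃ g ∈ S, U m g) ⊆
      ⋃ p ∈ S ×ˢ Q, U (m + 1) (p.1 + p.2) := by
    rintro x ⟨hx, hx'⟩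
    simp only [Set.mem_iUnion, exists_prop] at hx
    obtain ⟨f, hf, hx⟩ := hx
    obtain ⟨c, hc, hxc⟩ := (hU.split m f x).1 hx
    refine Set.mem_biUnion (x := (f, c)) (Finset.mem_product.2 ⟨hf, Finset.mem_filter.2
      ⟨hc, fun hch => hx' ⟨-h +ᵥ x, Set.mem_biUnion hf ?_, vadd_neg_vadd h x⟩⟩⟩) hxc
    refine hU.succ_subset hch f ((hU.vadd_mem_iff _ _ _ _).2 ?_)
    rwa [sub_neg_eq_add, add_assoc, sub_add_cancel]
  have hle : μ ((⋃ g ∈ S, U m g) \ (fun x => h +ᵥ x) '' ⋃ g ∈ S, U m g) ≤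
      (S.card * Q.card) * D.weight (m + 1) := by
    refine (measure_mono hsub).trans ((measure_biUnion_finset_le _ _).trans ?_)
    rw [Finset.sum_congr rfl fun p _ => hU.measure_eq_weight hμ (m + 1) (p.1 + p.2),
      Finset.sum_const, Finset.card_product, nsmul_eq_mul]
    push_cast
    rfl
  rw [hU.measure_biUnion hμ hS]
  calc ((n : ℝ≥0∞) + 1) * μ ((⋃ g ∈ S, U m g) \ (fun x => h +ᵥ x) '' ⋃ g ∈ S, U m g)
      ≤ ((n : ℝ≥0∞) + 1) * ((S.card * Q.card) * D.weight (m + 1)) := mul_le_mul' (by simp) hle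
    _ = S.card * (((n + 1) * Q.card : ℕ) * D.weight (m + 1)) := by push_cast; ring
    _ ≤ S.card * ((D.C m).card * D.weight (m + 1)) := by gcongr
    _ = S.card * D.weight m := by rw [D.weight_succ]

/-- At a rigid step a union of levels loses at most a fraction `1 / (n + 1)` under translation by `h
n`. Approximating `A` by such unions transfers this to `A`. -/
theorem isRigidAction [Countable G] (hU : IsLevelSystem D U) {μ : Measure X}
    (hμ : Normalizes D U μ) (hD : D.RigidSteps) : IsRigidAction G μ := by
  obtain ⟨φ, h, hφ, hh, hstep⟩ := hD
  refine ⟨h, hh, fun A hA hAfin => (ENNReal.tendsto_nhds hAfin).2 fun ε hε => ?_⟩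
  -- Three errors will be added: `A \ B`, `B \ T B` and `T B \ T A`. The minimum with `1` keeps `δ`
  -- finite.
  obtain ⟨δ, hδ, hδtop, hδε⟩ : ∃ δ : ℝ≥0∞, 0 < δ ∧ δ ≠ ⊤ ∧ 3 * δ ≤ ε := by
    refine ⟨min ε 1 / 3, ENNReal.div_pos (by simp [hε.ne']) (by norm_num), ?_, ?_⟩
    · exact ENNReal.div_ne_top (ne_top_of_le_ne_top ENNReal.one_ne_top (min_le_right _ _))
        (by norm_num)
    · rw [ENNReal.mul_div_cancel (by norm_num) (by norm_num)]
      exact min_le_left _ _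
  obtain ⟨N, hN⟩ := hU.exists_approx hμ hA hAfin hδ
  have hlim : Tendsto (fun n : ℕ => (μ A + δ) / ((n : ℝ≥0∞) + 1)) atTop (𝓝 0) := by
    have h1 : Tendsto (fun n : ℕ => (n : ℝ≥0∞) + 1) atTop (𝓝 ⊤) := by
      have := (tendsto_add_atTop_iff_nat 1).2 ENNReal.tendsto_nat_nhds_top
      simpa using this
    have := ENNReal.Tendsto.const_div h1 (Or.inr (ENNReal.add_ne_top.2 ⟨hAfin, hδtop⟩))
    simpa using this
  filter_upwards [eventually_ge_atTop N, ENNReal.tendsto_nhds_zero.1 hlim (δ) hδ]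
    with n hn hsmall
  obtain ⟨S, hS, hAB⟩ := hN (φ n) (hn.trans hφ.le_apply)
  set B := ⋃ g ∈ S, U (φ n) g with hB
  set T : Set X → Set X := fun E => (fun x => h n +ᵥ x) '' E
  have hBm : MeasurableSet B := hU.measurableSet_biUnion _ _
  have hAB' : μ (A \ B) ≤ δ := (measure_mono fun x hx => Or.inl hx).trans hAB.le
  have hBA : μ (B \ A) ≤ δ := (measure_mono fun x hx => Or.inr hx).trans hAB.le
  have hTBA : μ (T B \ T A) ≤ δ := by
    rw [← Set.image_sdiff (AddAction.injective (h n)), hU.measure_image_vadd hμ _ (hBm.diff hA)]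
    exact hBA
  have hBle : μ B ≤ μ A + δ := by
    refine (measure_mono (t := A ∪ (B \ A)) fun x hx => ?_).trans
      ((measure_union_le _ _).trans (by gcongr))
    by_cases hxA : x ∈ A
    · exact Or.inl hxA
    · exact Or.inr ⟨hx, hxA⟩
  have hBT : μ (B \ T B) ≤ δ := by
    refine le_trans ?_ hsmall
    rw [ENNReal.le_div_iff_mul_le (Or.inl (by positivity)) (Or.inl (by finiteness)), mul_comm]
    have := (hU.measure_diff_image_le hμ hS (h n) n (by convert hstep n)).trans hBle
    simpa using this
  constructor
  · rw [tsub_le_iff_right]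
    have hsub : A ⊆ (T A ∩ A) ∪ ((A \ B) ∪ ((B \ T B) ∪ (T B \ T A))) := by
      intro x hx
      simp only [Set.mem_union, Set.mem_inter_iff, Set.mem_sdiff]
      tauto
    calc μ A ≤ μ (T A ∩ A) + (μ (A \ B) + (μ (B \ T B) + μ (T B \ T A))) :=
          (measure_mono hsub).trans ((measure_union_le _ _).trans (add_le_add le_rfl
            ((measure_union_le _ _).trans (add_le_add le_rfl (measure_union_le _ _)))))
      _ ≤ μ (T A ∩ A) + (δ + (δ + δ)) := by gcongr
      _ = μ (T A ∩ A) + 3 * δ := by ring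
      _ ≤ μ (T A ∩ A) + ε := by gcongr
  · exact (measure_mono Set.inter_subset_right).trans le_self_add

end IsLevelSystem

/-! ### Ergodicity of the `k`-fold products. -/

/-- Bounded functions `a m`, `b m` satisfying a mean value property along the finite sets `K m`
coincide if they have a common value along sufficiently many of the averages. -/
theorem eq_of_averages {V : Type*} [AddCommGroup V] {K : ℕ → Finset V} {a b : ℕ → V → ℝ}
    (ha0 : ∀ m f, 0 ≤ a m f) (ha1 : ∀ m f, a m f ≤ 1) (hb0 : ∀ m f, 0 ≤ b m f)
    (hb1 : ∀ m f, b m f ≤ 1)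
    (ha : ∀ m f, ∑ c ∈ K m, a (m + 1) (f + c) = (K m).card * a m f)
    (hb : ∀ m f, ∑ c ∈ K m, b (m + 1) (f + c) = (K m).card * b m f)
    (hK : ∀ m, 0 < (K m).card) {κ : ℕ → ℝ} (hκ0 : ∀ m, 0 ≤ κ m)
    (hκ : ∀ m, κ m * (K m).card ≤ 1) (hsum : ¬ Summable κ)
    (heq : ∀ m, κ m ≠ 0 → ∃ c ∈ K m, ∃ c' ∈ K m, ∀ f, a (m + 1) (f + c) = b (m + 1) (f + c'))
    (m : ℕ) (f : V) : a m f = b m f := by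
  have hvar : ∀ (m : ℕ) (f : V) (u : ℕ → V → ℝ),
      ∑ c ∈ K m, u (m + 1) (f + c) = (K m).card * u m f →
      ∑ c ∈ K m, (u (m + 1) (f + c)) ^ 2 =
        (K m).card * (u m f) ^ 2 + ∑ c ∈ K m, (u (m + 1) (f + c) - u m f) ^ 2 := by
    intro m f u hu
    have : ∀ c, (u (m + 1) (f + c) - u m f) ^ 2 =
        (u (m + 1) (f + c)) ^ 2 - 2 * u m f * u (m + 1) (f + c) + (u m f) ^ 2 := fun c => by ring
    simp only [this, Finset.sum_add_distrib, Finset.sum_sub_distrib, ← Finset.mul_sum, hu,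
      Finset.sum_const, nsmul_eq_mul]
    ring
  -- Energy bound: averaging over `K m` raises the mean of the squares by the variance, and each
  -- coincidence forces a variance of at least `κ m / 2` times `(a - b) ^ 2`. As the functions are
  -- bounded, a nonzero `a - b` would bound the partial sums of `κ`.
  have key : ∀ (J m : ℕ) (f : V), (a m f) ^ 2 + (b m f) ^ 2 +
      1 / 2 * (∑ j ∈ Finset.range J, κ (m + j)) * (a m f - b m f) ^ 2 ≤ 2 := by
    intro J
    induction J with
    | zero =>
      intro m f
      have h1 := pow_le_one₀ (n := 2) (ha0 m f) (ha1 m f)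
      have h2 := pow_le_one₀ (n := 2) (hb0 m f) (hb1 m f)
      simp only [Finset.range_zero, Finset.sum_empty, mul_zero, zero_mul, add_zero]
      linarith
    | succ J ih =>
      intro m f
      set N : ℝ := ((K m).card : ℝ) with hN
      have hN0 : 0 < N := by
        rw [hN]
        exact_mod_cast hK m
      set S := ∑ j ∈ Finset.range J, κ (m + 1 + j) with hS
      have hS0 : 0 ≤ S := Finset.sum_nonneg fun j _ => hκ0 _
      have hsplit : ∑ j ∈ Finset.range (J + 1), κ (m + j) = S + κ m := by
        rw [Finset.sum_range_succ']
        simp only [add_zero, hS]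
        congr 1
        exact Finset.sum_congr rfl fun j _ => by congr 1; omega
      have h1 := Finset.sum_le_sum fun c (_ : c ∈ K m) => ih (m + 1) (f + c)
      rw [Finset.sum_add_distrib, Finset.sum_add_distrib, ← Finset.mul_sum, Finset.sum_const,
        nsmul_eq_mul, hvar m f a (ha m f), hvar m f b (hb m f), ← hS, ← hN] at h1
      have h2 : N * (a m f - b m f) ^ 2 ≤
          ∑ c ∈ K m, (a (m + 1) (f + c) - b (m + 1) (f + c)) ^ 2 := by
        have := hvar m f (fun m f => a m f - b m f) (by
          rw [Finset.sum_sub_distrib, ha, hb]; ring)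
        rw [this]
        exact le_add_of_nonneg_right (Finset.sum_nonneg fun c _ => sq_nonneg _)
      have h3 : 1 / 2 * (N * κ m) * (a m f - b m f) ^ 2 ≤
          ∑ c ∈ K m, (a (m + 1) (f + c) - a m f) ^ 2 +
          ∑ c ∈ K m, (b (m + 1) (f + c) - b m f) ^ 2 := by
        have hnn : ∀ u : ℕ → V → ℝ, ∀ c ∈ K m, 0 ≤ (u (m + 1) (f + c) - u m f) ^ 2 :=
          fun _ c _ => sq_nonneg _
        by_cases hz : κ m = 0
        · rw [hz, mul_zero, mul_zero, zero_mul]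
          exact add_nonneg (Finset.sum_nonneg (hnn a)) (Finset.sum_nonneg (hnn b))
        · obtain ⟨c, hc, c', hc', hcc⟩ := heq m hz
          have h4 := Finset.single_le_sum (hnn a) hc
          have h5 := Finset.single_le_sum (hnn b) hc'
          rw [← hcc f] at h5
          have h6 : N * κ m ≤ 1 := by rw [mul_comm]; exact hκ m
          have h7 : 1 / 2 * (N * κ m) * (a m f - b m f) ^ 2 ≤ 1 / 2 * (a m f - b m f) ^ 2 := by
            nlinarith [sq_nonneg (a m f - b m f)]
          -- For the common value `t`, `(t - a) ^ 2 + (t - b) ^ 2` is at least `(a - b) ^ 2 / 2`.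
          nlinarith [sq_nonneg ((a (m + 1) (f + c) - a m f) + (a (m + 1) (f + c) - b m f))]
      rw [hsplit]
      have h8 : 1 / 2 * S * (N * (a m f - b m f) ^ 2) ≤
          1 / 2 * S * ∑ c ∈ K m, (a (m + 1) (f + c) - b (m + 1) (f + c)) ^ 2 :=
        mul_le_mul_of_nonneg_left h2 (by positivity)
      have h9 : N * ((a m f) ^ 2 + (b m f) ^ 2 + 1 / 2 * (S + κ m) * (a m f - b m f) ^ 2) ≤
          N * 2 := by nlinarith
      exact le_of_mul_le_mul_left h9 hN0
  by_contra hne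
  have hpos : 0 < (a m f - b m f) ^ 2 := by
    have := sub_ne_zero.2 hne
    positivity
  refine hsum ((summable_nat_add_iff m).1 (summable_of_sum_range_le (c := 4 / (a m f - b m f) ^ 2)
    (fun j => hκ0 _) fun J => ?_))
  rw [le_div_iff₀ hpos]
  have := key J m f
  simp only [add_comm _ m]
  nlinarith [sq_nonneg (a m f), sq_nonneg (b m f)]

namespace IsLevelSystem

/-- The products of the sets `U m (f i)`. -/
def box {G X : Type*} {n : ℕ} (U : ℕ → G → Set X) (m : ℕ) (f : Fin n → G) : Set (Fin n → X) :=
  Set.univ.pi fun i => U m (f i)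

variable {G X : Type*} [AddCommGroup G] [mX : MeasurableSpace X] [AddAction G X]
  {D : CFData G} {U : ℕ → G → Set X} {n : ℕ}

theorem mem_box {G X : Type*} {n : ℕ} {U : ℕ → G → Set X} {m : ℕ} {f : Fin n → G}
    {x : Fin n → X} : x ∈ box U m f ↔ ∀ i, x i ∈ U m (f i) := by
  simp [box]

theorem measurableSet_box (hU : IsLevelSystem D U) (m : ℕ) (f : Fin n → G) :
    MeasurableSet (box U m f) :=
  MeasurableSet.univ_pi fun i => hU.measurableSet m (f i)

theorem box_split (hU : IsLevelSystem D U) (m : ℕ) (f : Fin n → G) :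
    box U m f = ⋃ c ∈ Fintype.piFinset fun _ : Fin n => D.C m, box U (m + 1) (f + c) := by
  ext x
  simp only [mem_box, Set.mem_iUnion, exists_prop, Fintype.mem_piFinset, Pi.add_apply]
  constructor
  · intro h
    choose c hc hx using fun i => (hU.split m (f i) (x i)).1 (h i)
    exact ⟨c, hc, hx⟩
  · rintro ⟨c, hc, hx⟩ i
    exact (hU.split m (f i) (x i)).2 ⟨c i, hc i, hx i⟩

theorem measure_inter_box (hU : IsLevelSystem D U) (ν : Measure (Fin n → X)) {A : Set (Fin n → X)}
    (hA : MeasurableSet A) (m : ℕ) (f : Fin n → G) :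
    ν (A ∩ box U m f) =
      ∑ c ∈ Fintype.piFinset fun _ : Fin n => D.C m, ν (A ∩ box U (m + 1) (f + c)) := by
  rw [hU.box_split m f, Set.inter_iUnion₂, measure_biUnion_finset]
  · intro c hc c' hc' hne
    obtain ⟨i, hi⟩ := Function.ne_iff.1 hne
    rw [Finset.mem_coe, Fintype.mem_piFinset] at hc hc'
    refine Set.disjoint_left.2 fun x hx hx' => ?_
    exact Set.disjoint_left.1 (hU.disj_split (f i) (hc i) (hc' i) hi) (mem_box.1 hx.2 i)
      (mem_box.1 hx'.2 i)
  · exact fun c _ => hA.inter (hU.measurableSet_box _ _)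

theorem measure_box [Countable G] (hU : IsLevelSystem D U) {μ : Measure X}
    (hμ : Normalizes D U μ) (m : ℕ) (f : Fin n → G) :
    Measure.pi (fun _ : Fin n => μ) (box U m f) = D.weight m ^ n := by
  have := hU.sigmaFinite hμ
  rw [box, Measure.pi_pi, Finset.prod_congr rfl fun i _ => hU.measure_eq_weight hμ m (f i),
    Finset.prod_const, Finset.card_univ, Fintype.card_fin]

/-- A measure on a power of `X` is determined by its values on products of levels. -/
theorem ext_of_box [Countable G] (hU : IsLevelSystem D U) {ν₁ ν₂ : Measure (Fin n → X)}
    (heq : ∀ m (f : Fin n → G), ν₁ (box U m f) = ν₂ (box U m f))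
    (hfin : ∀ m (f : Fin n → G), ν₁ (box U m f) ≠ ⊤) : ν₁ = ν₂ := by
  have hcommon : ∀ (x : Fin n → X) (N : ℕ), ∃ M ≥ N, ∃ f : Fin n → G, (∀ i, f i ∈ D.F M) ∧
      x ∈ box U M f := by
    intro x N
    choose L hL using fun i => hU.exists_mem (x i)
    let M := N + ∑ i, L i
    have hM : ∀ i, L i ≤ M := fun i =>
      (Finset.single_le_sum (fun i _ => Nat.zero_le (L i)) (Finset.mem_univ i)).trans
        (Nat.le_add_left _ _)
    choose f hf hx using fun i => hL i M (hM i)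
    exact ⟨M, Nat.le_add_right _ _, f, hf, mem_box.2 hx⟩
  refine Measure.ext_of_nested (B := fun m (f : Fin n → G) => box U m f)
    (I := fun m => {f | ∀ i, f i ∈ D.F m}) ?_ ?_ ?_ (fun m f _ => heq m f) fun m f _ => hfin m f
  · apply le_antisymm
    · refine iSup_le fun i => ?_
      rw [← measurable_iff_comap_le]
      have : @Measurable (Fin n → X) X (MeasurableSpace.generateFrom
          {s | ∃ m, ∃ f ∈ {f : Fin n → G | ∀ i, f i ∈ D.F m}, s = box U m f})
          (MeasurableSpace.generateFrom {s | ∃ m, ∃ f ∈ (D.F m : Set G), s = U m f})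
          (fun x => x i) := by
        refine @measurable_generateFrom _ _ (MeasurableSpace.generateFrom _) _ _ ?_
        rintro _ ⟨m, g, hg, rfl⟩
        have : (fun x : Fin n → X => x i) ⁻¹' U m g =
            ⋃ p ∈ {p : ℕ × (Fin n → G) | (∀ j, p.2 j ∈ D.F p.1) ∧ U p.1 (p.2 i) ⊆ U m g},
              box U p.1 p.2 := by
          apply Set.Subset.antisymm
          · intro x hx
            obtain ⟨M, hM, f, hf, hxf⟩ := hcommon x m
            refine Set.mem_biUnion (x := (M, f)) ⟨hf, ?_⟩ hxf
            exact hU.nested hM hg (hf i) ⟨x i, hx, mem_box.1 hxf i⟩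
          · exact Set.iUnion₂_subset fun p hp x hx => hp.2 (mem_box.1 hx i)
        rw [this]
        exact @MeasurableSet.biUnion _ _ (_) _ _ (Set.to_countable _) fun p hp =>
          MeasurableSpace.measurableSet_generateFrom ⟨p.1, p.2, hp.1, rfl⟩
      rwa [← hU.generate_levels] at this
    · refine MeasurableSpace.generateFrom_le ?_
      rintro _ ⟨m, f, -, rfl⟩
      exact hU.measurableSet_box m f
  · rintro m M hM f hf f' hf' ⟨x, hx, hx'⟩ y hy
    refine mem_box.2 fun i => ?_
    exact hU.nested hM (hf i) (hf' i) ⟨x i, mem_box.1 hx i, mem_box.1 hx' i⟩ (mem_box.1 hy i)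
  · intro x
    obtain ⟨M, -, f, hf, hx⟩ := hcommon x 0
    exact ⟨M, f, hf, hx⟩

/-- A defect in `C` allows to shift a single coordinate of a tuple by elements of the diagonal,
with signs `ε`. -/
theorem _root_.HasDefect.exists_shift {C : Finset G} {ε : Fin n → ℤ}
    (hε : ∀ i, ε i = 1 ∨ ε i = -1) (i₀ : Fin n) (v : G) (hC : HasDefect C (ε i₀ • v)) :
    ∃ c ∈ Fintype.piFinset fun _ : Fin n => C, ∃ c' ∈ Fintype.piFinset fun _ : Fin n => C, ∃ g : G,
      c + (fun i => ε i • g) = Pi.single i₀ v + c' := by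
  obtain ⟨a, ha, b, hb, d, hd, h⟩ := hC
  -- Away from `i₀`, adding `ε j • (b - a)` exchanges `a` and `b`. At `i₀` it passes between `b` and
  -- `d`, and the defect leaves the remainder `v`.
  refine ⟨fun j => if j = i₀ then (if ε j = 1 then b else d) else (if ε j = 1 then a else b), ?_,
    fun j => if j = i₀ then (if ε j = 1 then d else b) else (if ε j = 1 then b else a), ?_,
    b - a, ?_⟩
  · rw [Fintype.mem_piFinset]
    intro j
    split_ifs <;> assumption
  · rw [Fintype.mem_piFinset]
    intro j
    split_ifs <;> assumption
  · funext j
    by_cases hj : j = i₀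
    · subst hj
      rcases hε j with h1 | h1
      · simp only [h1, one_zsmul, Pi.add_apply, if_true, Pi.single_eq_same] at h ⊢
        rw [← h]
        abel
      · have h2 : ¬ ((-1 : ℤ) = 1) := by decide
        simp only [h1, neg_one_zsmul, Pi.add_apply, if_true, Pi.single_eq_same, if_neg h2] at h ⊢
        rw [← h]
        abel
    · rcases hε j with h1 | h1
      · simp [h1, hj]
      · have h2 : ¬ ((-1 : ℤ) = 1) := by decide
        simp [h1, hj, h2]

/-- The densities `a m f` of an invariant set in boxes are averages of the densities one stage later
and do not change under signed diagonal shifts. Defects upgrade this to invariance under shifts of a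
single coordinate, so the density is constant. The signs `ε` treat `T` and `T⁻¹` together. -/
theorem productErgodic [Countable G] (hU : IsLevelSystem D U) {μ : Measure X}
    (hμ : Normalizes D U μ) (hD : D.Mixes n) (S : Fin n → AddAction G X) (ε : Fin n → ℤ)
    (hε : ∀ i, ε i = 1 ∨ ε i = -1)
    (hS : ∀ i g x, (S i).toVAdd.vadd g x = (ε i • g) +ᵥ x) : ProductErgodic S μ := by
  have := hU.sigmaFinite hμ
  let _ : VAdd G (Fin n → X) := (productAction S).toVAdd
  set ν := Measure.pi fun _ : Fin n => μ with hν
  have hact : ∀ (g : G) (x : Fin n → X), g +ᵥ x = fun i => (ε i • g) +ᵥ x i :=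
    fun g x => funext fun i => hS i g (x i)
  have hmp : ∀ g : G, MeasurePreserving (fun x : Fin n → X => g +ᵥ x) ν ν := by
    intro g
    simp only [hact]
    exact measurePreserving_pi _ _ fun i => hU.measurePreserving hμ (ε i • g)
  refine @ErgodicVAdd.mk G (Fin n → X) _ _ ν ⟨fun g s hs =>
    (hmp g).measure_preimage hs.nullMeasurableSet⟩ ?_
  intro A hA hinv
  have hpre : ∀ (g : G) m (f : Fin n → G),
      (fun x : Fin n → X => g +ᵥ x) ⁻¹' box U m (f + fun i => ε i • g) = box U m f := by
    intro g m f
    ext x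
    simp only [Set.mem_preimage, mem_box, hact, Pi.add_apply]
    exact forall_congr' fun i => by rw [add_comm, hU.vadd_mem]
  have hq : ∀ (g : G) m (f : Fin n → G),
      ν (A ∩ box U m (f + fun i => ε i • g)) = ν (A ∩ box U m f) := by
    intro g m f
    rw [← (hmp g).measure_preimage (hA.inter (hU.measurableSet_box _ _)).nullMeasurableSet,
      Set.preimage_inter, hpre]
    exact measure_congr ((hinv g).inter (ae_eq_refl _))
  have hboxfin : ∀ m (f : Fin n → G), ν (box U m f) ≠ ⊤ := fun m f => by
    rw [hU.measure_box hμ]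
    exact ENNReal.pow_ne_top (D.weight_ne_top m)
  have hqfin : ∀ m (f : Fin n → G), ν (A ∩ box U m f) ≠ ⊤ := fun m f =>
    measure_ne_top_of_subset Set.inter_subset_right (hboxfin m f)
  let W : ℕ → ℝ := fun m => (D.weight m ^ n).toReal
  have hW : ∀ m, 0 < W m := fun m => ENNReal.toReal_pos (pow_ne_zero _ (D.weight_ne_zero m))
    (ENNReal.pow_ne_top (D.weight_ne_top m))
  let K : ℕ → Finset (Fin n → G) := fun m => Fintype.piFinset fun _ => D.C m
  have hKcard : ∀ m, (K m).card = (D.C m).card ^ n := fun m => by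
    simp only [K, Fintype.card_piFinset_const]
  have hK : ∀ m, 0 < (K m).card := fun m => by
    rw [hKcard]
    exact pow_pos (D.card_pos m) n
  have hWK : ∀ m, W m = (K m).card * W (m + 1) := by
    intro m
    simp only [W]
    rw [← D.weight_succ m, mul_pow, ENNReal.toReal_mul, hKcard]
    simp
  obtain ⟨a, ha_def⟩ : ∃ a : ℕ → (Fin n → G) → ℝ,
      ∀ m f, a m f = (ν (A ∩ box U m f)).toReal / W m := ⟨_, fun _ _ => rfl⟩
  have ha0 : ∀ m f, 0 ≤ a m f := fun m f => by
    rw [ha_def]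
    exact div_nonneg ENNReal.toReal_nonneg (hW m).le
  have ha1 : ∀ m f, a m f ≤ 1 := by
    intro m f
    rw [ha_def, div_le_one (hW m)]
    refine ENNReal.toReal_mono (ENNReal.pow_ne_top (D.weight_ne_top m)) ?_
    rw [← hU.measure_box hμ m f]
    exact measure_mono Set.inter_subset_right
  have ha : ∀ m f, ∑ c ∈ K m, a (m + 1) (f + c) = (K m).card * a m f := by
    intro m f
    simp only [ha_def]
    rw [← Finset.sum_div, ← ENNReal.toReal_sum fun c _ => hqfin _ _,
      ← hU.measure_inter_box ν hA m f, hWK m]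
    have h1 := (hW (m + 1)).ne'
    have h2 : ((K m).card : ℝ) ≠ 0 := by exact_mod_cast (hK m).ne'
    field_simp
  have hshift : ∀ (i : Fin n) (v : G) m f, a m f = a m (f + Pi.single i v) := by
    classical
    intro i v
    -- The weight `κ m` is the reciprocal of the number of sub-boxes, `|C m| ^ n`, whenever the
    -- required defect is present.
    refine eq_of_averages (a := a) (b := fun m f => a m (f + Pi.single i v)) (K := K) ha0 ha1 (fun m f => ha0 _ _)
      (fun m f => ha1 _ _) ha (fun m f => ?_) hK (κ := fun m =>
        if HasDefect (D.C m) (ε i • v) then (((D.C m).card : ℝ) ^ n)⁻¹ else 0)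
      (fun m => ite_nonneg (inv_nonneg.2 (pow_nonneg (Nat.cast_nonneg _) n)) le_rfl) (fun m => ?_) (hD _) fun m hm => ?_
    · rw [← ha m]
      exact Finset.sum_congr rfl fun c _ => by rw [add_right_comm]
    · have h2 : ((K m).card : ℝ) ≠ 0 := by exact_mod_cast (hK m).ne'
      split_ifs
      · rw [hKcard] at h2 ⊢
        push_cast at h2 ⊢
        rw [inv_mul_cancel₀ h2]
      · simp
    · have hdef : HasDefect (D.C m) (ε i • v) := by
        by_contra h
        exact hm (if_neg h)
      obtain ⟨c, hc, c', hc', g, hg⟩ := hdef.exists_shift hε i v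
      refine ⟨c, hc, c', hc', fun f => ?_⟩
      simp only [ha_def]
      rw [← hq g, add_assoc, hg, ← add_assoc, add_right_comm, add_right_comm f]
  have hconst : ∀ m f, a m f = a m 0 := by
    classical
    intro m f
    have : ∀ s : Finset (Fin n), a m (∑ i ∈ s, Pi.single i (f i)) = a m 0 := by
      intro s
      induction s using Finset.induction_on with
      | empty => simp
      | insert i s hi ih => rw [Finset.sum_insert hi, add_comm, ← hshift, ih]
    rw [← this Finset.univ, Finset.univ_sum_single]
  have hstep : ∀ m, a m 0 = a 0 0 := by
    intro m
    induction m with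
    | zero => rfl
    | succ m ih =>
      have h1 := ha m 0
      simp only [hconst (m + 1), Finset.sum_const, nsmul_eq_mul] at h1
      have h2 : ((K m).card : ℝ) ≠ 0 := by exact_mod_cast (hK m).ne'
      rw [← ih]
      exact mul_left_cancel₀ h2 h1
  -- Evaluated on the complement of `A`, this leaves only a null or a conull set.
  have hρ : ν.restrict A = ENNReal.ofReal (a 0 0) • ν := by
    have hval : ∀ m (f : Fin n → G), (ν.restrict A) (box U m f) = ν (A ∩ box U m f) :=
      fun m f => by rw [Measure.restrict_apply (hU.measurableSet_box m f), Set.inter_comm]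
    refine hU.ext_of_box (fun m f => ?_) fun m f => by rw [hval]; exact hqfin m f
    rw [hval, Measure.smul_apply, smul_eq_mul, ← hstep m, ← hconst m f, hU.measure_box hμ m f]
    rw [← ENNReal.ofReal_toReal (ENNReal.pow_ne_top (D.weight_ne_top m)),
      ← ENNReal.ofReal_mul (ha0 m f), ha_def, div_mul_cancel₀ _ (hW m).ne',
      ENNReal.ofReal_toReal (hqfin m f)]
  have hzero : ENNReal.ofReal (a 0 0) * ν Aᶜ = 0 := by
    have := congrArg (fun m : Measure (Fin n → X) => m Aᶜ) hρ
    simpa [Measure.restrict_apply hA.compl] using this.symm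
  rw [eventuallyConst_set]
  rcases mul_eq_zero.1 hzero with h | h
  · right
    have := congrArg (fun m : Measure (Fin n → X) => m Set.univ) hρ
    rw [h] at this
    have : ν A = 0 := by simpa using this
    rw [ae_iff]
    simpa using this
  · left
    rw [ae_iff]
    exact h

end IsLevelSystem

/-! ### Non-ergodicity of the `(k + 1)`-fold product. -/

namespace IsLevelSystem

variable {G X : Type*} [AddCommGroup G] [mX : MeasurableSpace X] [T : AddAction G X]
  {D : CFData G} {U : ℕ → G → Set X} {n : ℕ}

/-- The tuples of points all of whose coordinates make a choice in `Q m` at stage `m`. -/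
def exceptional (D : CFData G) (U : ℕ → G → Set X) (Q : ℕ → Finset G) (n m : ℕ) :
    Set (Fin n → X) :=
  ⋃ z ∈ Fintype.piFinset fun _ : Fin n => D.F m, ⋃ c ∈ Fintype.piFinset fun _ : Fin n => Q m,
    box U (m + 1) (z + c)

theorem measurableSet_exceptional (hU : IsLevelSystem D U) (Q : ℕ → Finset G) (m : ℕ) :
    MeasurableSet (exceptional D U Q n m) :=
  Finset.measurableSet_biUnion _ fun _ _ => Finset.measurableSet_biUnion _ fun _ _ =>
    hU.measurableSet_box _ _

/-- The `n` coordinates choose independently and uniformly at each stage; splitting the box reduces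
stage `l + j` to the case `j = 0`. -/
theorem measure_exceptional_le [Countable G] (hU : IsLevelSystem D U) {μ : Measure X}
    (hμ : Normalizes D U μ) {Q : ℕ → Finset G} (hQ : ∀ m, Q m ⊆ D.C m) (j l : ℕ) (f : Fin n → G)
    (hf : ∀ i, f i ∈ D.F l) :
    Measure.pi (fun _ : Fin n => μ) (exceptional D U Q n (l + j) ∩ box U l f) ≤
      (((Q (l + j)).card : ℝ≥0∞) / (D.C (l + j)).card) ^ n * D.weight l ^ n := by
  induction j generalizing l f with
  | zero =>
    have hsub : exceptional D U Q n l ∩ box U l f ⊆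
        ⋃ c ∈ Fintype.piFinset fun _ : Fin n => Q l, box U (l + 1) (f + c) := by
      rintro x ⟨hx, hxf⟩
      simp only [exceptional, Set.mem_iUnion, exists_prop] at hx
      obtain ⟨z, hz, c, hc, hx⟩ := hx
      rw [Fintype.mem_piFinset] at hz
      have hzf : z = f := by
        funext i
        refine hU.disj l _ (hz i) _ (hf i) (x i) ?_ (mem_box.1 hxf i)
        exact hU.succ_subset (hQ l (Fintype.mem_piFinset.1 hc i)) _ (mem_box.1 hx i)
      subst hzf
      exact Set.mem_biUnion hc hx
    refine (measure_mono hsub).trans ((measure_biUnion_finset_le _ _).trans (le_of_eq ?_))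
    rw [Finset.sum_congr rfl fun c _ => hU.measure_box hμ (l + 1) (f + c), Finset.sum_const,
      Fintype.card_piFinset_const, nsmul_eq_mul, ← mul_pow, ← D.weight_succ l]
    push_cast
    rw [← mul_pow, add_zero, ← mul_assoc, ENNReal.div_mul_cancel]
    · exact_mod_cast (D.card_pos l).ne'
    · exact ENNReal.natCast_ne_top _
  | succ j ih =>
    rw [hU.measure_inter_box _ (hU.measurableSet_exceptional Q _)]
    have h1 : ∀ c ∈ Fintype.piFinset fun _ : Fin n => D.C l,
        Measure.pi (fun _ : Fin n => μ) (exceptional D U Q n (l + (j + 1)) ∩ box U (l + 1) (f + c)) ≤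
        (((Q (l + (j + 1))).card : ℝ≥0∞) / (D.C (l + (j + 1))).card) ^ n *
          D.weight (l + 1) ^ n := by
      intro c hc
      rw [Fintype.mem_piFinset] at hc
      have := ih (l + 1) (f + c) fun i => D.add_mem l _ (hf i) _ (hc i)
      rwa [show l + 1 + j = l + (j + 1) by omega] at this
    refine (Finset.sum_le_sum h1).trans (le_of_eq ?_)
    rw [Finset.sum_const, Fintype.card_piFinset_const, nsmul_eq_mul, ← D.weight_succ l]
    push_cast
    rw [mul_pow]
    ring

/-- Off the exceptional sets, translates preserve the differences of the addresses of the
coordinates. -/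
theorem sub_eq_sub_of_vadd (hU : IsLevelSystem D U) {Q : ℕ → Finset G}
    (hex : ∀ m, ExactOff (D.F m) (D.C m) (Q m)) {f f' : Fin n → G} (hf : ∀ i, f i ∈ D.F 0)
    (hf' : ∀ i, f' i ∈ D.F 0) {x : Fin n → X} (hx : x ∈ box U 0 f) {g : G}
    (hgx : (fun i => g +ᵥ x i) ∈ box U 0 f') (hnot : ∀ m, x ∉ exceptional D U Q n m) (i j : Fin n) :
    f' i - f i = f' j - f j := by
  choose z hz0 hz using fun i => hU.exists_path (hf i) (mem_box.1 hx i)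
  choose z' hz0' hz' using fun i => hU.exists_path (hf' i) (mem_box.1 hgx i)
  let H : ℕ → Prop := fun m => ∀ i j, z' i m - z i m = z' j m - z j m
  -- Some coordinate `i₀` chooses outside `Q m`, so exactness applies to the pair `(i₀, j)` for
  -- every `j`; only the choices of `x`, not those of its translate, have to avoid `Q m`.
  have hdown : ∀ m, H (m + 1) → H m := by
    intro m hm
    obtain ⟨i₀, hi₀⟩ : ∃ i₀, z i₀ (m + 1) - z i₀ m ∉ Q m := by
      by_contra hcon
      push Not at hcon
      refine hnot m (Set.mem_biUnion (x := fun i => z i m)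
        (Fintype.mem_piFinset.2 fun i => (hz i m).1) (Set.mem_biUnion
        (x := fun i => z i (m + 1) - z i m) (Fintype.mem_piFinset.2 hcon) (mem_box.2 fun i => ?_)))
      rw [Pi.add_apply, add_sub_cancel]
      exact (hz i (m + 1)).2.1
    have key : ∀ j, z' j m - z j m = z' i₀ m - z i₀ m := by
      intro j
      have hmj := hm j i₀
      have := hex m _ (hz i₀ m).2.2 hi₀ _ (hz' i₀ m).2.2 _ (hz j m).2.2 _ (hz' j m).2.2 _ (hz' j m).1
        _ (hz j m).1 _ (hz' i₀ m).1 _ (hz i₀ m).1 (by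
          rw [show z' i₀ (m + 1) - z' i₀ m - (z i₀ (m + 1) - z i₀ m) -
              (z' j (m + 1) - z' j m - (z j (m + 1) - z j m)) =
            (z' i₀ (m + 1) - z i₀ (m + 1)) - (z' j (m + 1) - z j (m + 1)) +
              ((z' j m - z j m) - (z' i₀ m - z i₀ m)) by abel, hmj, sub_self, zero_add])
      have h2 : z' j m - z j m - (z' i₀ m - z i₀ m) =
          (z' j (m + 1) - z j (m + 1)) - (z' i₀ (m + 1) - z i₀ (m + 1)) +
          ((z' i₀ (m + 1) - z' i₀ m - (z i₀ (m + 1) - z i₀ m)) -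
            (z' j (m + 1) - z' j m - (z j (m + 1) - z j m))) := by abel
      rw [this, hmj, sub_self, sub_self, add_zero] at h2
      exact sub_eq_zero.1 h2
    exact fun i j => (key i).trans (key j).symm
  obtain ⟨N, hN⟩ := eventually_atTop.1 (D.absorb g)
  -- At a stage that absorbs `g`, every coordinate changes its address by exactly `g`.
  have hlarge : H (N + 1) := by
    have : ∀ i, z' i (N + 1) - z i (N + 1) = g := by
      intro i
      have h1 : g + z i (N + 1) ∈ D.F (N + 1) := by
        have := hN N le_rfl _ (hz i N).1 _ (hz i N).2.2
        rwa [add_sub_cancel] at this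
      have h2 := (hU.vadd_mem (N + 1) (z i (N + 1)) g (x i)).2 (hz i (N + 1)).2.1
      rw [hU.disj _ _ (hz' i (N + 1)).1 _ h1 _ (hz' i (N + 1)).2.1 h2, add_sub_cancel_right]
    exact fun i j => (this i).trans (this j).symm
  have hall : ∀ j m, m + j = N + 1 → H m := by
    intro j
    induction j with
    | zero => rintro m rfl; exact hlarge
    | succ j ih => exact fun m hm => hdown m (ih (m + 1) (by omega))
  have := hall (N + 1) 0 (by omega) i j
  rwa [hz0, hz0, hz0', hz0'] at this

/-- The saturation of the non-exceptional part of the box at `0` misses the non-exceptional part of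
the box at `(h₀, 0, …, 0)`: the address change would be `-h₀` in coordinate `0` and `0` in
coordinate `1`. Both parts have positive measure, since these boxes have measure `1` and the
exceptional sets take up less than that. -/
theorem not_productErgodic [Countable G] (hU : IsLevelSystem D U)
    {μ : Measure X} (hμ : Normalizes D U μ) (hD : D.Isolates (n + 2)) {h₀ : G} (hh : h₀ ∈ D.F 0)
    (hh0 : h₀ ≠ 0) : ¬ ProductErgodic (fun _ : Fin (n + 2) => T) μ := by
  have := hU.sigmaFinite hμ
  obtain ⟨Q, hQC, hex, hsum⟩ := hD
  intro herg
  let _ : VAdd G (Fin (n + 2) → X) := (productAction fun _ : Fin (n + 2) => T).toVAdd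
  set ν := Measure.pi fun _ : Fin (n + 2) => μ with hν
  have hact : ∀ (g : G) (x : Fin (n + 2) → X), g +ᵥ x = fun i => g +ᵥ x i := fun g x => rfl
  let E : Set (Fin (n + 2) → X) := ⋃ m, exceptional D U Q (n + 2) m
  have hE : MeasurableSet E := MeasurableSet.iUnion fun m => hU.measurableSet_exceptional Q m
  have hpos : ∀ f : Fin (n + 2) → G, (∀ i, f i ∈ D.F 0) → ν (box U 0 f \ E) ≠ 0 := by
    intro f hf h0
    have h1 : ν (E ∩ box U 0 f) < 1 := by
      refine lt_of_le_of_lt ?_ hsum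
      rw [Set.iUnion_inter]
      refine (measure_iUnion_le _).trans (ENNReal.tsum_le_tsum fun m => ?_)
      have := hU.measure_exceptional_le hμ hQC m 0 f hf
      simpa [CFData.weight] using this
    have h2 : ν (box U 0 f) = 1 := by simp [hν, hU.measure_box hμ, CFData.weight]
    have h3 := measure_inter_add_sdiff (μ := ν) (box U 0 f) hE
    rw [h0, add_zero, Set.inter_comm, h2] at h3
    exact h1.ne h3
  have hinj : ∀ f f' : Fin (n + 2) → G, (∀ i, f i ∈ D.F 0) → (∀ i, f' i ∈ D.F 0) →
      ∀ g : G, ∀ x ∈ box U 0 f \ E, g +ᵥ x ∈ box U 0 f' \ E → ∀ i j, f' i - f i = f' j - f j := by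
    intro f f' hf hf' g x hx hgx
    exact hU.sub_eq_sub_of_vadd hex hf hf' hx.1 hgx.1 fun m hm => hx.2 (Set.mem_iUnion.2 ⟨m, hm⟩)
  let f₁ : Fin (n + 2) → G := Pi.single 0 h₀
  have hf₀ : ∀ i : Fin (n + 2), (0 : Fin (n + 2) → G) i ∈ D.F 0 := fun i => D.zero_mem 0
  have hf₁ : ∀ i, f₁ i ∈ D.F 0 := by
    intro i
    by_cases hi : i = 0
    · subst hi
      simpa [f₁] using hh
    · simpa [f₁, hi] using D.zero_mem 0
  let A : Set (Fin (n + 2) → X) := ⋃ g : G, (fun x => g +ᵥ x) ⁻¹' (box U 0 0 \ E)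
  have hmeas : ∀ g : G, Measurable fun x : Fin (n + 2) → X => g +ᵥ x := by
    intro g
    simp only [hact]
    exact measurable_pi_iff.2 fun i => (hU.measurable_vadd g).comp (measurable_pi_apply i)
  have hA : MeasurableSet A := MeasurableSet.iUnion fun g =>
    hmeas g ((hU.measurableSet_box 0 0).diff hE)
  have hinv : ∀ g : G, (fun x : Fin (n + 2) → X => g +ᵥ x) ⁻¹' A = A := by
    intro g
    ext x
    simp only [A, Set.mem_preimage, Set.mem_iUnion, hact, vadd_vadd]
    constructor
    · rintro ⟨g', h⟩
      exact ⟨_, h⟩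
    · rintro ⟨g', h⟩
      exact ⟨g' - g, by simpa using h⟩
  have hdisj : Disjoint (box U 0 f₁ \ E) A := by
    refine Set.disjoint_left.2 fun x hx hxA => ?_
    obtain ⟨g, hg⟩ := Set.mem_iUnion.1 hxA
    have := hinj f₁ 0 hf₁ hf₀ g x hx hg 0 1
    simp [f₁, hh0] at this
  have hconst := herg.aeconst_of_forall_preimage_vadd_ae_eq hA fun g => by
    rw [hinv g]
    exact ae_eq_refl A
  rcases eventuallyConst_set.1 hconst with h | h
  · refine hpos f₁ hf₁ (measure_mono_null ?_ (ae_iff.1 h))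
    exact fun x hx hxA => Set.disjoint_left.1 hdisj hx hxA
  · refine hpos 0 hf₀ (measure_mono_null (t := {x | ¬ x ∉ A}) ?_ (ae_iff.1 h))
    intro x hx
    exact not_not.2 (Set.mem_iUnion.2 ⟨0, by simpa [hact] using hx⟩)

end IsLevelSystem

/-! ### Assembly of the action and the two cases of the theorem. -/

/-- Existence of the action along towers whose shapes belong to a given cofinal family. -/
theorem exists_action {G : Type*} [AddCommGroup G] [Countable G] {h₀ : G}
    (hh : ¬ IsOfFinAddOrder h₀) {𝓕 : Set (Finset G)} (h𝓕 : ∀ K : Finset G, ∃ F ∈ 𝓕, K ⊆ F) {k : ℕ}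
    (hk : 0 < k) :
    ∃ (X : Type) (_ : MeasurableSpace X) (_ : AddAction G X) (μ : Measure X),
      IsInfiniteMeasurePreserving G μ ∧ IsRigidAction G μ ∧
      (∃ F : ℕ → Finset G, (∀ n, F n ∈ 𝓕) ∧ IsFunnyRankOneAlong μ F) ∧
      HasErgodicIndex G μ k ∧ ∀ m < k, MixedProductErgodic G μ m k := by
  have hinf : Infinite G :=
    Infinite.of_injective _ (injective_zsmul_iff_not_isOfFinAddOrder.2 hh)
  obtain ⟨_⟩ := nonempty_denumerable G
  let e : G ≃ ℕ := Denumerable.eqv G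
  obtain ⟨D, hF, hh₀, hrig, hmix, hiso⟩ := CFData.exists_data e hh h𝓕 k
  let T : AddAction G (D.Space e) := D.spaceAction e
  have hU := D.isLevelSystem e
  have hμ := D.normalizes_spaceMeasure e
  refine ⟨D.Space e, inferInstance, T, D.spaceMeasure e,
    hU.isInfiniteMeasurePreserving inferInstance hμ, hU.isRigidAction hμ hrig,
    ⟨D.F, hF, hU.isFunnyRankOneAlong hμ⟩, ⟨?_, ?_⟩, fun m _ => ?_⟩
  · exact hU.productErgodic hμ hmix _ (fun _ => 1) (fun _ => Or.inl rfl) fun i g x => by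
      rw [one_zsmul]
      rfl
  -- Positivity of `k` supplies the two coordinates that are compared in the `(k + 1)`-fold product.
  · obtain ⟨k, rfl⟩ : ∃ j, k = j + 1 := ⟨k - 1, by omega⟩
    refine hU.not_productErgodic hμ hiso hh₀ ?_
    rintro rfl
    exact hh IsOfFinAddOrder.zero
  · refine hU.productErgodic hμ hmix _ (fun i => if i.val < m then 1 else -1)
      (fun i => by split_ifs <;> simp) fun i g x => ?_
    by_cases hi : i.val < m
    · rw [if_pos hi, if_pos hi, one_zsmul]
      rfl
    · rw [if_neg hi, if_neg hi, neg_one_zsmul]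
      rfl

theorem exists_isCube_superset {d : ℕ} (K : Finset (Fin d → ℤ)) :
    ∃ F ∈ {F : Finset (Fin d → ℤ) | IsCube F}, K ⊆ F := by
  let L : ℕ := ∑ x ∈ K, ∑ i, (x i).natAbs
  refine ⟨_, ⟨fun _ => -(L : ℤ), 2 * L, rfl⟩, fun x hx => ?_⟩
  have hle : ∀ i, (x i).natAbs ≤ L := fun i =>
    (Finset.single_le_sum (f := fun i => (x i).natAbs) (fun _ _ => Nat.zero_le _)
      (Finset.mem_univ i)).trans
      (Finset.single_le_sum (f := fun x : Fin d → ℤ => ∑ i, (x i).natAbs)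
        (fun _ _ => Nat.zero_le _) hx)
  rw [Finset.mem_Icc]
  constructor <;> intro i <;> have := hle i <;> push_cast <;> omega

theorem theorem0p1 :
    (∀ (G : Type*) [AddCommGroup G] [Countable G], (∃ g : G, ¬ IsOfFinAddOrder g) →
      ∀ k : ℕ, 0 < k →
        ∃ (X : Type) (_ : MeasurableSpace X) (_ : AddAction G X) (μ : Measure X),
          IsInfiniteMeasurePreserving G μ ∧ IsRigidAction G μ ∧ IsFunnyRankOne G μ ∧
          HasErgodicIndex G μ k ∧ ∀ m < k, MixedProductErgodic G μ m k) ∧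
    (∀ d : ℕ, 0 < d → ∀ k : ℕ, 0 < k →
        ∃ (X : Type) (_ : MeasurableSpace X) (_ : AddAction (Fin d → ℤ) X) (μ : Measure X),
          IsInfiniteMeasurePreserving (Fin d → ℤ) μ ∧ IsRigidAction (Fin d → ℤ) μ ∧
          IsRankOne d μ ∧
          HasErgodicIndex (Fin d → ℤ) μ k ∧
          ∀ m < k, MixedProductErgodic (Fin d → ℤ) μ m k) := by
  constructor
  · rintro G _ _ ⟨g, hg⟩ k hk
    obtain ⟨X, i₁, i₂, μ, h1, h2, ⟨F, -, h3⟩, h4⟩ :=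
      exists_action hg (𝓕 := Set.univ) (fun K => ⟨K, trivial, subset_rfl⟩) hk
    exact ⟨X, i₁, i₂, μ, h1, h2, ⟨F, h3⟩, h4⟩
  · intro d hd k hk
    have hg : ¬ IsOfFinAddOrder (fun _ : Fin d => (1 : ℤ)) := by
      rw [← injective_zsmul_iff_not_isOfFinAddOrder]
      intro a b hab
      simpa using congrFun hab ⟨0, hd⟩
    exact exists_action hg exists_isCube_superset hk
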